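/- Let $N\ge 1$. For a permutation $w$ of $\{1,\dots,N\}$ let $\mathrm{inv}(w)$ be its number of inversions, i.e. of pairs $i<j$ with $w(i)>w(j)$. For $q\in[0,1)$ the Mallows measure $\mathcal M_N^q$ assigns to $w$ the probability $q^{\mathrm{inv}(w)}/\sum_v q^{\mathrm{inv}(v)}$, the sum being over all permutations $v$ of $\{1,\dots,N\}$. For integers $L,K\ge 0$ let $$H_{L,K}(w)=\#\{i:\ 1\le i\le L,\ 1\le w(i)\le K\}$$ be the height function. For $\beta>0$ and $x,y\in(0,1)$ put $$h_\beta(x,y)=\frac1\beta\Big[\ln(1-e^{-\beta})-\ln\big(e^{-\beta x}+e^{-\beta y}-e^{-\beta(x+y)}-e^{-\beta}\big)\Big],$$ $$d_\beta(x,y)=\tfrac12\ln(1-e^{-\beta})-\tfrac12\ln\big(1-e^{-\beta(x-h_\beta(x,y))}\big)-\tfrac12\ln\big(1-e^{-\beta(y-h_\beta(x,y))}\big),$$ $$\sigma_{N,\beta}(x,y)=\frac{\sqrt N}{\sqrt\beta\,e^{d_\beta(x,y)}},$$ and let $\mathcal N(t)=\frac1{\sqrt{2\pi}}e^{-t^2/2}$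 be the standard normal density. Theorem (local central limit theorem for the height function). Fix $\beta>0$ and let $q=1-\beta/N$. Let $(A_N)$ be a non-decreasing sequence of real numbers with $\lim_{N\to\infty}A_N/N^{1/6}=0$. Then for any $x,y\in(0,1)$, as $N\to\infty$, $$\max_{k\in\mathbb Z:\ |k-h_\beta(x,y)N|<\sqrt N\,A_N}\left|\frac{\sigma_{N,\beta}(x,y)\,\mathcal M_N^q\big(H_{\lfloor xN\rfloor,\lfloor yN\rfloor}=k\big)}{\mathcal N\!\left(\frac{k-h_\beta(x,y)N}{\sigma_{N,\beta}(x,y)}\right)}-1\right|=O\!\left(\frac{A_N^3}{\sqrt N}\right);$$ that is, there is a constant $C$, depending on $\beta,x,y$ and the sequence $(A_N)$ but not on $N$ or $k$, such that for all sufficiently large $N$ the left-hand side is at most $C A_N^3/\sqrt N$ (nothing is claimed when there is no such $k$). -/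

import Mathlib

namespace Mallows

/-- The number of inversions of a permutation `w`: pairs `i < j` with `w i > w j`. -/
def inv {N : ℕ} (w : Equiv.Perm (Fin N)) : ℕ :=
  (Finset.univ.filter fun p : Fin N × Fin N => p.1 < p.2 ∧ w p.2 < w p.1).card

/-- The normalising sum `∑_w q ^ inv(w)` over all permutations of size `N`. -/
noncomputable def partitionFunction (N : ℕ) (q : ℝ) : ℝ :=
  ∑ w : Equiv.Perm (Fin N), q ^ inv w

/-- The Mallows probability `q ^ inv(w) / ∑_v q ^ inv(v)` of a single permutation. -/
noncomputable def mass (N : ℕ) (q : ℝ) (w : Equiv.Perm (Fin N)) : ℝ :=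
  q ^ inv w / partitionFunction N q

/-- The Mallows probability of an event, i.e. of a set of permutations of size `N`. -/
noncomputable def prob (N : ℕ) (q : ℝ) (E : Set (Equiv.Perm (Fin N))) : ℝ :=
  ∑ w : Equiv.Perm (Fin N), E.indicator (mass N q) w

/-- The height function `H_{L,K}(w) = #{i : 1 ≤ i ≤ L, 1 ≤ w(i) ≤ K}`. The element `i : Fin N`
stands for `i + 1 ∈ {1, …, N}`, so `i + 1 ≤ L` reads `i < L`. -/
def height {N : ℕ} (L K : ℕ) (w : Equiv.Perm (Fin N)) : ℕ :=
  (Finset.univ.filter fun i : Fin N => (i : ℕ) < L ∧ (w i : ℕ) < K).card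

/-- The limit shape `h_β(x, y)` of the height function. -/
noncomputable def h (β x y : ℝ) : ℝ :=
  (1 / β) * (Real.log (1 - Real.exp (-β)) -
    Real.log (Real.exp (-β * x) + Real.exp (-β * y) - Real.exp (-β * (x + y)) - Real.exp (-β)))

/-- The function `d_β(x, y)` that governs the fluctuations of the height function. -/
noncomputable def d (β x y : ℝ) : ℝ :=
  (1 / 2) * Real.log (1 - Real.exp (-β)) -
    (1 / 2) * Real.log (1 - Real.exp (-β * (x - h β x y))) -
    (1 / 2) * Real.log (1 - Real.exp (-β * (y - h β x y)))

/-- The standard deviation `σ_{N,β}(x, y) = √N / (√β · exp(d_β(x, y)))`. -/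
noncomputable def σ (N : ℕ) (β x y : ℝ) : ℝ :=
  Real.sqrt N / (Real.sqrt β * Real.exp (d β x y))

theorem partitionFunction_pos (N : ℕ) {q : ℝ} (hq : 0 ≤ q) : 0 < partitionFunction N q := by
  unfold partitionFunction
  refine Finset.sum_pos' (fun w _ => pow_nonneg hq _) ⟨1, Finset.mem_univ _, ?_⟩
  have h1 : inv (1 : Equiv.Perm (Fin N)) = 0 := by
    unfold inv
    rw [Finset.card_eq_zero, Finset.filter_eq_empty_iff]
    rintro p - ⟨h1, h2⟩
    exact absurd h1 (not_lt.mpr (le_of_lt h2))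
  simp [h1]

theorem mass_nonneg (N : ℕ) {q : ℝ} (hq : 0 ≤ q) (w : Equiv.Perm (Fin N)) : 0 ≤ mass N q w :=
  div_nonneg (pow_nonneg hq _) (partitionFunction_pos N hq).le

theorem prob_univ (N : ℕ) {q : ℝ} (hq : 0 ≤ q) : prob N q Set.univ = 1 := by
  unfold prob mass
  simp only [Set.indicator_univ]
  rw [← Finset.sum_div]
  exact div_self (partitionFunction_pos N hq).ne'

end Mallows

/-!
The law of the height function under the Mallows measure is `q`-hypergeometric: if `k` points of
the permutation lie in the rectangle of sides `L` and `K`, and `b = L - k`, `c = K - k`,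
`d = N - L - K + k`, the weight of this event is proportional to
`q ^ (b c) / ([k]! [b]! [c]! [d]!)`. This is `weight_formula`, proved by removing the last position
of the permutation. Only the resulting odds of consecutive heights (`prob_height_succ_mul`) enter
the asymptotics, so no `q`-Stirling formula is needed.

For `q = 1 - β / N` the logarithm of the odds at height `h N + i` is a smooth function of `i / N`
up to `O(1 / N)`. It vanishes at the limit shape `h` (`log_odds_h_eq_zero`), where its derivative
is `-β e ^ (2 d) = -1 / v` (`exp_two_mul_d_eq_sum`). Hence the log-odds are
`-i / (v N) + O(1 / N + i² / N²)` (`exists_heightProb_succ_eq`), and adding them up gives the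
Gaussian profile around the centre with an error `O(m / N + m³ / N²)` in the exponent at
distance `m` (`exists_eq_exp_of_increments`).

The value at the centre is found from the total mass one. Each step lowers the odds by a factor of
at least `q²` (`heightProb_mul_le`), which gives a Gaussian upper bound on the whole line and makes
the error of the profile summable uniformly in `N` (`exists_abs_div_sub_exp_le`). Poisson summation
evaluates the sum of the profile as `√(2 π v N) + O(1)`, so the central probability is
`1 / √(2 π v N)` up to a relative error `O(1 / √N)` (`exists_abs_inv_sub_sqrt_le`).

Finally a non-decreasing `A` is either never positive, when no `k` is admitted, or bounded
below by some `a > 0` from some point on, when every error above is `O(A N ^ 3 / √N)`.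
-/

namespace Mallows

/-! ### The law of the height function -/

/-- The permutation of `n + 1` points that takes the last point to `v` and whose other values are
in the same relative order as those of `u`. -/
def appendValue {n : ℕ} (v : Fin (n + 1)) (u : Equiv.Perm (Fin n)) : Equiv.Perm (Fin (n + 1)) :=
  finSuccEquivLast.trans ((Equiv.optionCongr u).trans (finSuccEquiv' v).symm)

@[simp] theorem appendValue_last {n : ℕ} (v : Fin (n + 1)) (u : Equiv.Perm (Fin n)) :
    appendValue v u (Fin.last n) = v := by
  simp [appendValue]

@[simp] theorem appendValue_castSucc {n : ℕ} (v : Fin (n + 1)) (u : Equiv.Perm (Fin n))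
    (i : Fin n) : appendValue v u i.castSucc = v.succAbove (u i) := by
  simp [appendValue]

theorem appendValue_bijective (n : ℕ) :
    Function.Bijective fun p : Fin (n + 1) × Equiv.Perm (Fin n) => appendValue p.1 p.2 := by
  rw [Fintype.bijective_iff_injective_and_card]
  constructor
  · rintro ⟨v, u⟩ ⟨v', u'⟩ h
    have hv : v = v' := by
      have := congrArg (fun w : Equiv.Perm (Fin (n + 1)) => w (Fin.last n)) h
      simpa using this
    subst hv
    congr 1
    ext i
    have := congrArg (fun w : Equiv.Perm (Fin (n + 1)) => w i.castSucc) h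
    simp only [appendValue_castSucc] at this
    rw [Fin.succAbove_right_injective this]
  · simp [Fintype.card_perm, Nat.factorial_succ]

theorem inv_eq_sum {N : ℕ} (w : Equiv.Perm (Fin N)) :
    inv w = ∑ j, ∑ i, if i < j ∧ w j < w i then 1 else 0 := by
  unfold inv
  rw [Finset.card_filter, Fintype.sum_prod_type, Finset.sum_comm]

theorem inv_appendValue {n : ℕ} (v : Fin (n + 1)) (u : Equiv.Perm (Fin n)) :
    inv (appendValue v u) = inv u + (n - v) := by
  rw [inv_eq_sum, inv_eq_sum, Fin.sum_univ_castSucc]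
  congr 1
  · refine Finset.sum_congr rfl fun j _ => ?_
    rw [Fin.sum_univ_castSucc]
    simp [(Fin.castSucc_lt_last j).not_gt]
  · rw [Fin.sum_univ_castSucc]
    simp only [Fin.castSucc_lt_last, appendValue_last, appendValue_castSucc, true_and, lt_irrefl,
      false_and, if_false, add_zero]
    rw [Equiv.sum_comp u (fun i => if v < v.succAbove i then 1 else 0)]
    simp only [Fin.lt_succAbove_iff_le_castSucc, Fin.le_def, Fin.val_castSucc]
    rw [Fin.sum_univ_eq_sum_range (fun i => if (v : ℕ) ≤ i then 1 else 0) n,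
      ← Finset.card_filter]
    have : (Finset.range n).filter (fun i => (v : ℕ) ≤ i) = Finset.Ico (v : ℕ) n := by
      ext i; simp [and_comm]
    rw [this, Nat.card_Ico]

theorem height_eq_sum {N : ℕ} (L K : ℕ) (w : Equiv.Perm (Fin N)) :
    height L K w = ∑ i : Fin N, if (i : ℕ) < L ∧ (w i : ℕ) < K then 1 else 0 := by
  unfold height
  rw [Finset.card_filter]

theorem height_appendValue {n : ℕ} {L : ℕ} (hL : L ≤ n) (K : ℕ) (v : Fin (n + 1))
    (u : Equiv.Perm (Fin n)) :
    height L K (appendValue v u) = height L (if (v : ℕ) < K then K - 1 else K) u := by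
  rw [height_eq_sum, height_eq_sum, Fin.sum_univ_castSucc]
  simp only [Fin.val_last, hL.not_gt, false_and, if_false, add_zero, Fin.val_castSucc,
    appendValue_castSucc]
  refine Finset.sum_congr rfl fun i _ => ?_
  have : ((v.succAbove (u i) : ℕ) < K) ↔ ((u i : ℕ) < if (v : ℕ) < K then K - 1 else K) := by
    unfold Fin.succAbove
    split_ifs with h1 h2 h2 <;> simp only [Fin.lt_def, Fin.val_castSucc, Fin.val_succ] at * <;>
      omega
  simp only [this]

theorem height_le_left {N : ℕ} (L K : ℕ) (w : Equiv.Perm (Fin N)) : height L K w ≤ L := by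
  unfold height
  calc _ ≤ (Finset.range L).card := by
        refine Finset.card_le_card_of_injOn (fun i => (i : ℕ)) ?_ (Fin.val_injective.injOn)
        intro i hi
        simp only [Finset.coe_filter, Set.mem_ofPred_eq] at hi
        simpa using hi.2.1
    _ = L := Finset.card_range L

theorem height_le_right {N : ℕ} (L K : ℕ) (w : Equiv.Perm (Fin N)) : height L K w ≤ K := by
  unfold height
  calc _ ≤ (Finset.range K).card := by
        refine Finset.card_le_card_of_injOn (fun i => (w i : ℕ)) ?_
          ((Fin.val_injective.comp w.injective).injOn)
        intro i hi
        simp only [Finset.coe_filter, Set.mem_ofPred_eq] at hi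
        simpa using hi.2.2
    _ = K := Finset.card_range K

theorem add_le_height_add {N L K : ℕ} (hL : L ≤ N) (hK : K ≤ N) (w : Equiv.Perm (Fin N)) :
    L + K ≤ N + height L K w := by
  have h1 : (Finset.univ.filter fun i : Fin N => (i : ℕ) < L).card = L := by
    rw [Fin.card_filter_val_lt, min_eq_right hL]
  have h2 : (Finset.univ.filter fun i : Fin N => (w i : ℕ) < K).card = K := by
    rw [Finset.card_filter, Equiv.sum_comp w (fun i => if (i : ℕ) < K then 1 else 0),
      ← Finset.card_filter, Fin.card_filter_val_lt, min_eq_right hK]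
  have h3 := Finset.card_union_add_card_inter (Finset.univ.filter fun i : Fin N => (i : ℕ) < L)
    (Finset.univ.filter fun i : Fin N => (w i : ℕ) < K)
  rw [h1, h2, ← Finset.filter_and] at h3
  have h4 := Finset.card_le_univ ((Finset.univ.filter fun i : Fin N => (i : ℕ) < L) ∪
    (Finset.univ.filter fun i : Fin N => (w i : ℕ) < K))
  rw [Fintype.card_fin] at h4
  unfold height
  omega

/-- The total weight `∑ q ^ inv(w)` of the permutations of size `N` with
`height L K w = k`. -/
noncomputable def weight (q : ℝ) (N L K k : ℕ) : ℝ :=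
  ∑ w : Equiv.Perm (Fin N), if height L K w = k then q ^ inv w else 0

/-- The `q`-number `[n] = 1 + q + ⋯ + q ^ (n - 1)`. -/
noncomputable def qNumber (q : ℝ) (n : ℕ) : ℝ := ∑ i ∈ Finset.range n, q ^ i

/-- The `q`-factorial `[n]! = [1] [2] ⋯ [n]`. -/
noncomputable def qFactorial (q : ℝ) (n : ℕ) : ℝ := ∏ i ∈ Finset.range n, qNumber q (i + 1)

theorem qFactorial_succ (q : ℝ) (n : ℕ) :
    qFactorial q (n + 1) = qFactorial q n * qNumber q (n + 1) :=
  Finset.prod_range_succ _ _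

theorem qNumber_add (q : ℝ) (m n : ℕ) : qNumber q (m + n) = qNumber q m + q ^ m * qNumber q n := by
  simp only [qNumber, Finset.sum_range_add, pow_add, Finset.mul_sum]

theorem qNumber_succ_pos {q : ℝ} (hq : 0 < q) (n : ℕ) : 0 < qNumber q (n + 1) :=
  Finset.sum_pos (fun _ _ => pow_pos hq _) ⟨0, by simp⟩

theorem qFactorial_pos {q : ℝ} (hq : 0 < q) (n : ℕ) : 0 < qFactorial q n :=
  Finset.prod_pos fun _ _ => qNumber_succ_pos hq _

theorem qNumber_mul_one_sub (q : ℝ) (n : ℕ) : qNumber q n * (1 - q) = 1 - q ^ n :=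
  geom_sum_mul_neg q n

theorem weight_eq_zero_of_ne (q : ℝ) {N L K k : ℕ}
    (h : ∀ w : Equiv.Perm (Fin N), height L K w ≠ k) : weight q N L K k = 0 :=
  Finset.sum_eq_zero fun w _ => if_neg (h w)

/-- Recursion obtained by removing the last position: as it is not among the first `L`, it does not
count towards the height, but a last value `< K` leaves only `K - 1` values `< K`. -/
theorem weight_succ (q : ℝ) {n L K : ℕ} (hL : L ≤ n) (hK : K ≤ n + 1) (k : ℕ) :
    weight q (n + 1) L K k =
      qNumber q (n + 1 - K) * weight q n L K k +
        q ^ (n + 1 - K) * qNumber q K * weight q n L (K - 1) k := by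
  have step : weight q (n + 1) L K k = ∑ v : Fin (n + 1), q ^ (n - (v : ℕ)) *
      weight q n L (if (v : ℕ) < K then K - 1 else K) k := by
    unfold weight
    rw [← (appendValue_bijective n).sum_comp, Fintype.sum_prod_type]
    refine Finset.sum_congr rfl fun v _ => ?_
    rw [Finset.mul_sum]
    refine Finset.sum_congr rfl fun u _ => ?_
    rw [height_appendValue hL, inv_appendValue, mul_ite, mul_zero, pow_add, mul_comm]
  rw [step, Fin.sum_univ_eq_sum_range
    (fun v => q ^ (n - v) * weight q n L (if v < K then K - 1 else K) k) (n + 1),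
    ← Finset.sum_range_reflect]
  have hsplit : n + 1 = (n + 1 - K) + K := by omega
  conv_lhs => rw [hsplit]
  rw [Finset.sum_range_add, qNumber, qNumber, Finset.sum_mul, Finset.mul_sum, Finset.sum_mul]
  congr 1
  · refine Finset.sum_congr rfl fun i hi => ?_
    rw [Finset.mem_range] at hi
    rw [if_neg (by omega), show n - (n + 1 - K + K - 1 - i) = i by omega]
  · refine Finset.sum_congr rfl fun i hi => ?_
    rw [Finset.mem_range] at hi
    rw [if_pos (by omega), show n - (n + 1 - K + K - 1 - (n + 1 - K + i)) = n + 1 - K + i by omega,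
      pow_add]

/-- The law of the height function is `q`-hypergeometric. Here `a`, `b`, `c`, `d` count the
points of the graph of `w` in the four rectangles cut out by position `L = a + b` and
value `K = a + c`. -/
theorem weight_formula (q : ℝ) (a b c d : ℕ) :
    weight q (a + b + c + d) (a + b) (a + c) a *
        (qFactorial q a * qFactorial q b * qFactorial q c * qFactorial q d) =
      partitionFunction (a + b) q * q ^ (b * c) * qFactorial q (c + d) * qFactorial q (a + c) *
        qFactorial q (b + d) := by
  induction hs : c + d generalizing c d with
  | zero =>
    obtain ⟨rfl, rfl⟩ : c = 0 ∧ d = 0 := by omega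
    have h1 : ∀ w : Equiv.Perm (Fin (a + b)), height (a + b) a w = a := by
      intro w
      have h1 := height_le_right (a + b) a w
      have h2 := add_le_height_add le_rfl (Nat.le_add_right a b) w
      omega
    have h2 : qFactorial q 0 = 1 := rfl
    have h3 : weight q (a + b + 0 + 0) (a + b) (a + 0) a = partitionFunction (a + b) q :=
      Finset.sum_congr rfl fun w _ => if_pos (h1 w)
    rw [h3]
    simp only [add_zero, h2, mul_one, mul_zero, pow_zero]
    ring
  | succ s ih =>
    have hN : a + b + c + d = (a + b + s) + 1 := by omega
    rw [hN, weight_succ q (by omega) (by omega),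
      show a + b + s + 1 - (a + c) = b + d by omega]
    -- the two summands are the shares `[d]` and `q ^ d [c]` of `[c + d] = [d] + q ^ d [c]`
    have e1 : weight q (a + b + s) (a + b) (a + c) a * qNumber q (b + d) *
        (qFactorial q a * qFactorial q b * qFactorial q c * qFactorial q d) =
        qNumber q d * (partitionFunction (a + b) q * q ^ (b * c) * qFactorial q s *
          qFactorial q (a + c) * qFactorial q (b + d)) := by
      rcases d with _ | d
      · rcases b with _ | b
        · simp [qNumber]
        have : weight q (a + (b + 1) + s) (a + (b + 1)) (a + c) a = 0 := by
          apply weight_eq_zero_of_ne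
          intro w hw
          have := add_le_height_add (N := a + (b + 1) + s) (L := a + (b + 1)) (K := a + c)
            (by omega) (by omega) w
          omega
        simp [this, qNumber]
      · have := ih c d (by omega)
        rw [show a + b + c + d = a + b + s by omega] at this
        rw [← add_assoc b d 1, qFactorial_succ, qFactorial_succ]
        linear_combination (qNumber q (d + 1) * qNumber q (b + d + 1)) * this
    have e2 : q ^ (b + d) * qNumber q (a + c) * weight q (a + b + s) (a + b) (a + c - 1) a *
        (qFactorial q a * qFactorial q b * qFactorial q c * qFactorial q d) =
        q ^ d * qNumber q c * (partitionFunction (a + b) q * q ^ (b * c) * qFactorial q s *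
          qFactorial q (a + c) * qFactorial q (b + d)) := by
      rcases c with _ | c
      · rcases a with _ | a
        · simp [qNumber]
        · have : weight q (a + 1 + b + s) (a + 1 + b) (a + 1 + 0 - 1) (a + 1) = 0 := by
            apply weight_eq_zero_of_ne
            intro w hw
            have := height_le_right (a + 1 + b) (a + 1 + 0 - 1) w
            omega
          rw [this]
          simp [qNumber]
      · have := ih c d (by omega)
        rw [show a + b + c + d = a + b + s by omega] at this
        rw [← add_assoc a c 1, Nat.add_sub_cancel, qFactorial_succ, qFactorial_succ]
        linear_combination (q ^ (b + d) * qNumber q (c + 1) * qNumber q (a + c + 1)) * this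
    have e3 : qFactorial q (s + 1) = qFactorial q s * (qNumber q d + q ^ d * qNumber q c) := by
      rw [qFactorial_succ, ← hs, add_comm c d, qNumber_add]
    rw [e3]
    linear_combination e1 + e2

theorem weight_pos {q : ℝ} (hq : 0 < q) (a b c d : ℕ) :
    0 < weight q (a + b + c + d) (a + b) (a + c) a := by
  have h1 := weight_formula q a b c d
  have h2 : 0 < qFactorial q a * qFactorial q b * qFactorial q c * qFactorial q d :=
    mul_pos (mul_pos (mul_pos (qFactorial_pos hq _) (qFactorial_pos hq _)) (qFactorial_pos hq _))
      (qFactorial_pos hq _)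
  have h3 : 0 < partitionFunction (a + b) q * q ^ (b * c) * qFactorial q (c + d) *
      qFactorial q (a + c) * qFactorial q (b + d) :=
    mul_pos (mul_pos (mul_pos (mul_pos (partitionFunction_pos _ hq.le) (pow_pos hq _))
      (qFactorial_pos hq _)) (qFactorial_pos hq _)) (qFactorial_pos hq _)
  rw [← h1] at h3
  exact pos_of_mul_pos_left h3 h2.le

/-- Two consecutive weights, with the factors of the `q`-hypergeometric law in which they
differ. -/
theorem weight_succ_mul (q : ℝ) (hq : 0 < q) (a b c d : ℕ) :
    weight q (a + b + c + d + 2) (a + b + 1) (a + c + 1) (a + 1) *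
        (q ^ (b + c + 1) * (1 - q ^ (a + 1)) * (1 - q ^ (d + 1))) =
      weight q (a + b + c + d + 2) (a + b + 1) (a + c + 1) a *
        ((1 - q ^ (b + 1)) * (1 - q ^ (c + 1))) := by
  have h1 := weight_formula q (a + 1) b c (d + 1)
  have h2 := weight_formula q a (b + 1) (c + 1) d
  rw [show a + 1 + b + c + (d + 1) = a + b + c + d + 2 by omega,
    show a + 1 + b = a + b + 1 by omega, show a + 1 + c = a + c + 1 by omega] at h1
  rw [show a + (b + 1) + (c + 1) + d = a + b + c + d + 2 by omega,
    show a + (b + 1) = a + b + 1 by omega, show a + (c + 1) = a + c + 1 by omega,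
    show c + 1 + d = c + (d + 1) by omega, show b + 1 + d = b + (d + 1) by omega] at h2
  simp only [qFactorial_succ q a, qFactorial_succ q b, qFactorial_succ q c,
    qFactorial_succ q d] at h1 h2
  have hpow : q ^ ((b + 1) * (c + 1)) = q ^ (b * c) * q ^ (b + c + 1) := by
    rw [← pow_add]; congr 1; ring
  rw [hpow] at h2
  have h2' : 0 < qFactorial q a * qFactorial q b * qFactorial q c * qFactorial q d :=
    mul_pos (mul_pos (mul_pos (qFactorial_pos hq _) (qFactorial_pos hq _)) (qFactorial_pos hq _))
      (qFactorial_pos hq _)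
  simp only [← qNumber_mul_one_sub]
  apply mul_right_cancel₀ h2'.ne'
  linear_combination (1 - q) ^ 2 * (q ^ (b + c + 1) * h1 - h2)

theorem prob_height_eq (N : ℕ) (q : ℝ) (L K k : ℕ) :
    prob N q {w | (height L K w : ℤ) = k} = weight q N L K k / partitionFunction N q := by
  unfold prob weight mass
  rw [Finset.sum_div]
  refine Finset.sum_congr rfl fun w _ => ?_
  by_cases h : height L K w = k
  · simp [h]
  · simp [h]

theorem prob_height_nonneg (N : ℕ) {q : ℝ} (hq : 0 ≤ q) (L K : ℕ) (k : ℤ) :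
    0 ≤ prob N q {w | (height L K w : ℤ) = k} :=
  Finset.sum_nonneg fun w _ => Set.indicator_nonneg (fun w _ => mass_nonneg N hq w) w

theorem prob_height_eq_zero {N : ℕ} (q : ℝ) {L K : ℕ} (hL : L ≤ N) (hK : K ≤ N) {k : ℤ}
    (h : k < 0 ∨ k < L + K - N ∨ (L : ℤ) < k ∨ (K : ℤ) < k) :
    prob N q {w | (height L K w : ℤ) = k} = 0 := by
  unfold prob
  refine Finset.sum_eq_zero fun w _ => Set.indicator_of_notMem ?_ _
  intro hw
  rw [Set.mem_ofPred_eq] at hw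
  have h1 := height_le_left L K w
  have h2 := height_le_right L K w
  have h3 := add_le_height_add hL hK w
  omega

theorem hasSum_prob_height (N : ℕ) {q : ℝ} (hq : 0 ≤ q) (L K : ℕ) :
    HasSum (fun k : ℤ => prob N q {w | (height L K w : ℤ) = k}) 1 := by
  rw [← prob_univ N hq]
  unfold prob
  refine hasSum_sum fun w _ => ?_
  convert hasSum_ite_eq (height L K w : ℤ) (mass N q w) using 2 with k
  · by_cases h : (height L K w : ℤ) = k
    · simp [h]
    · simp [h, Ne.symm h]
  · simp

/-- The odds of height `k + 1` against height `k`, for every `k` that admits both. -/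
theorem prob_height_succ_mul {N : ℕ} {q : ℝ} (hq : 0 < q) {L K : ℕ} {k : ℤ}
    (h0 : 0 ≤ k) (h1 : (L : ℤ) + K - N ≤ k) (h2 : k < L) (h3 : k < K) :
    prob N q {w | (height L K w : ℤ) = (k + 1 : ℤ)} *
        (q ^ (L + K - 2 * k - 1) * (1 - q ^ (k + 1)) * (1 - q ^ (N - L - K + k + 1))) =
      prob N q {w | (height L K w : ℤ) = k} * ((1 - q ^ (L - k)) * (1 - q ^ (K - k))) := by
  obtain ⟨a, rfl⟩ := Int.eq_ofNat_of_zero_le h0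
  obtain ⟨b, rfl⟩ : ∃ b, L = a + b + 1 := ⟨L - a - 1, by omega⟩
  obtain ⟨c, rfl⟩ : ∃ c, K = a + c + 1 := ⟨K - a - 1, by omega⟩
  obtain ⟨d, rfl⟩ : ∃ d, N = a + b + c + d + 2 := ⟨N - (a + b + c + 2), by omega⟩
  have key := weight_succ_mul q hq a b c d
  have e1 : (((a + b + 1 : ℕ) : ℤ) + (a + c + 1 : ℕ) - 2 * (a : ℤ) - 1) = (b + c + 1 : ℕ) := by
    push_cast; ring
  have e2 : ((a + b + c + d + 2 : ℕ) : ℤ) - (a + b + 1 : ℕ) - (a + c + 1 : ℕ) + a + 1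
      = (d + 1 : ℕ) := by
    push_cast; ring
  have e3 : ((a + b + 1 : ℕ) : ℤ) - a = (b + 1 : ℕ) := by push_cast; ring
  have e4 : ((a + c + 1 : ℕ) : ℤ) - a = (c + 1 : ℕ) := by push_cast; ring
  have e5 : (a : ℤ) + 1 = (a + 1 : ℕ) := by push_cast; ring
  rw [e1, e2, e3, e4, e5, prob_height_eq, prob_height_eq]
  simp only [zpow_natCast]
  rw [div_mul_eq_mul_div, div_mul_eq_mul_div, key]

theorem prob_height_pos {N : ℕ} {q : ℝ} (hq : 0 < q) {L K : ℕ} {k : ℤ}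
    (h0 : 0 ≤ k) (h1 : (L : ℤ) + K - N ≤ k) (h2 : k ≤ L) (h3 : k ≤ K) :
    0 < prob N q {w | (height L K w : ℤ) = k} := by
  obtain ⟨a, rfl⟩ := Int.eq_ofNat_of_zero_le h0
  obtain ⟨b, rfl⟩ : ∃ b, L = a + b := ⟨L - a, by omega⟩
  obtain ⟨c, rfl⟩ : ∃ c, K = a + c := ⟨K - a, by omega⟩
  obtain ⟨d, rfl⟩ : ∃ d, N = a + b + c + d := ⟨N - (a + b + c), by omega⟩
  rw [prob_height_eq]
  exact div_pos (weight_pos hq a b c d) (partitionFunction_pos _ hq.le)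

/-! ### Gaussian sums over the integers -/

theorem summable_exp_neg_mul_int_sq {a : ℝ} (ha : 0 < a) :
    Summable fun n : ℤ => Real.exp (-a * (n : ℝ) ^ 2) := by
  have h := summable_pow_mul_jacobiTheta₂_term_bound 0 (T := a / Real.pi)
    (div_pos ha Real.pi_pos) 0
  refine h.congr fun n => ?_
  rw [pow_zero, one_mul]
  congr 1
  field_simp
  simp

/-- Poisson summation compares the Gaussian sum with the Gaussian integral. -/
theorem exists_abs_tsum_exp_sub_sqrt_le :
    ∃ M : ℝ, 0 ≤ M ∧ ∀ a : ℝ, 0 < a → a ≤ Real.pi →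
      |∑' n : ℤ, Real.exp (-a * (n : ℝ) ^ 2) - Real.sqrt (Real.pi / a)| ≤ M := by
  refine ⟨∑' n : ℤ, Real.exp (-(Real.pi ^ 2 / (2 * Real.pi)) * (n : ℝ) ^ 2),
    tsum_nonneg fun n => (Real.exp_pos _).le, fun a ha hle => ?_⟩
  have hpi := Real.pi_pos
  have hP := Real.tsum_exp_neg_mul_int_sq (a := a / Real.pi) (div_pos ha hpi)
  have e1 : ∀ n : ℤ, -Real.pi * (a / Real.pi) * (n : ℝ) ^ 2 = -a * (n : ℝ) ^ 2 := by
    intro n; field_simp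
  have e2 : ∀ n : ℤ, -Real.pi / (a / Real.pi) * (n : ℝ) ^ 2 =
      -(Real.pi ^ 2 / a) * (n : ℝ) ^ 2 := by
    intro n; field_simp
  simp only [e1, e2] at hP
  have e3 : 1 / (a / Real.pi) ^ (1 / 2 : ℝ) = Real.sqrt (Real.pi / a) := by
    rw [← Real.sqrt_eq_rpow, one_div, ← Real.sqrt_inv, inv_div]
  rw [e3] at hP
  have hs := summable_exp_neg_mul_int_sq (a := Real.pi ^ 2 / a) (by positivity)
  have hs2 := summable_exp_neg_mul_int_sq (a := Real.pi ^ 2 / (2 * Real.pi)) (by positivity)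
  rw [hP, hs.tsum_eq_add_tsum_ite 0]
  have hz : Real.exp (-(Real.pi ^ 2 / a) * ((0 : ℤ) : ℝ) ^ 2) = 1 := by simp
  rw [hz, mul_add, mul_one, add_sub_cancel_left, ← tsum_mul_left]
  have hterm : ∀ n : ℤ, 0 ≤ Real.sqrt (Real.pi / a) *
      (if n = 0 then 0 else Real.exp (-(Real.pi ^ 2 / a) * (n : ℝ) ^ 2)) := by
    intro n
    split_ifs
    · simp
    · positivity
  have hterm2 : ∀ n : ℤ, Real.sqrt (Real.pi / a) *
      (if n = 0 then 0 else Real.exp (-(Real.pi ^ 2 / a) * (n : ℝ) ^ 2)) ≤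
        Real.exp (-(Real.pi ^ 2 / (2 * Real.pi)) * (n : ℝ) ^ 2) := by
    intro n
    split_ifs with hn
    · rw [mul_zero]; exact (Real.exp_pos _).le
    -- half of the exponent pays for the factor `√(π / a) ≤ exp (π / (2 a))`
    have h1 : Real.sqrt (Real.pi / a) ≤ Real.exp (Real.pi / a / 2) := by
      refine Real.sqrt_le_iff.mpr ⟨(Real.exp_pos _).le, ?_⟩
      have : Real.exp (Real.pi / a / 2) ^ 2 = Real.exp (Real.pi / a) := by
        rw [← Real.exp_nat_mul]; congr 1; push_cast; ring
      rw [this]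
      linarith [Real.add_one_le_exp (Real.pi / a)]
    have h2 : (1 : ℝ) ≤ (n : ℝ) ^ 2 := by
      have : (1 : ℤ) ≤ n ^ 2 := by have := sq_nonneg n; have := pow_ne_zero 2 hn; omega
      exact_mod_cast this
    calc _ ≤ Real.exp (Real.pi / a / 2) * Real.exp (-(Real.pi ^ 2 / a) * (n : ℝ) ^ 2) := by gcongr
      _ = Real.exp (Real.pi / a / 2 + -(Real.pi ^ 2 / a) * (n : ℝ) ^ 2) := by rw [Real.exp_add]
      _ ≤ _ := by
        apply Real.exp_le_exp.mpr
        have h3 : Real.pi / a / 2 ≤ Real.pi ^ 2 / (2 * a) * (n : ℝ) ^ 2 := by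
          have : Real.pi / a / 2 ≤ Real.pi ^ 2 / (2 * a) := by
            rw [div_div, mul_comm a 2]
            apply div_le_div_of_nonneg_right _ (by positivity)
            nlinarith [Real.pi_gt_three]
          calc _ ≤ Real.pi ^ 2 / (2 * a) * 1 := by rwa [mul_one]
            _ ≤ _ := by gcongr
        have h4 : Real.pi ^ 2 / (2 * Real.pi) * (n : ℝ) ^ 2 ≤
            Real.pi ^ 2 / (2 * a) * (n : ℝ) ^ 2 := by gcongr
        have h5 : Real.pi ^ 2 / a * (n : ℝ) ^ 2 = 2 * (Real.pi ^ 2 / (2 * a) * (n : ℝ) ^ 2) := by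
          field_simp
        linarith
  have hsum : Summable fun n : ℤ => Real.sqrt (Real.pi / a) *
      (if n = 0 then 0 else Real.exp (-(Real.pi ^ 2 / a) * (n : ℝ) ^ 2)) :=
    Summable.of_nonneg_of_le hterm hterm2 hs2
  rw [abs_of_nonneg (tsum_nonneg hterm)]
  exact hsum.tsum_le_tsum hterm2 hs2

/-! ### Sequences with almost linear logarithmic increments -/

theorem exists_add_pow_three_mul_exp_le {c : ℝ} (hc : 0 < c) :
    ∃ D : ℝ, 0 ≤ D ∧ ∀ s : ℝ, 0 ≤ s →
      (s + s ^ 3) * Real.exp (-(2 * c) * s ^ 2) ≤ D * Real.exp (-c * s ^ 2) := by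
  refine ⟨2 + 4 / c ^ 2, by positivity, fun s hs => ?_⟩
  have h1 : s + s ^ 3 ≤ (2 + 4 / c ^ 2) * Real.exp (c * s ^ 2) := by
    have h2 := Real.quadratic_le_exp_of_nonneg (x := c * s ^ 2) (by positivity)
    have h3 : 1 + c ^ 2 * s ^ 4 / 2 ≤ Real.exp (c * s ^ 2) := by
      have : 0 ≤ c * s ^ 2 := by positivity
      nlinarith
    have h4 : s ≤ 1 + s ^ 4 := by nlinarith [sq_nonneg (s ^ 2 - 1 / 2), sq_nonneg (s - 1 / 2)]
    have h5 : s ^ 3 ≤ 1 + s ^ 4 := by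
      nlinarith [sq_nonneg (s ^ 2 - s / 2), sq_nonneg (s ^ 2 - 1), sq_nonneg (s - 1)]
    calc s + s ^ 3 ≤ 2 * (1 + s ^ 4) := by linarith
      _ ≤ (2 + 4 / c ^ 2) * (1 + c ^ 2 * s ^ 4 / 2) := by
        have : (2 + 4 / c ^ 2) * (1 + c ^ 2 * s ^ 4 / 2) =
          2 * (1 + s ^ 4) + (c ^ 2 * s ^ 4 + 4 / c ^ 2) := by field_simp; ring
        rw [this]
        have : 0 ≤ c ^ 2 * s ^ 4 + 4 / c ^ 2 := by positivity
        linarith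
      _ ≤ _ := by gcongr
  calc _ ≤ (2 + 4 / c ^ 2) * Real.exp (c * s ^ 2) * Real.exp (-(2 * c) * s ^ 2) := by gcongr
    _ = _ := by rw [mul_assoc, ← Real.exp_add]; congr 2; ring

theorem abs_exp_sub_exp_le (a b : ℝ) :
    |Real.exp a - Real.exp b| ≤ |a - b| * max (Real.exp a) (Real.exp b) := by
  wlog h : b ≤ a generalizing a b
  · rw [abs_sub_comm, abs_sub_comm a, max_comm]
    exact this b a (le_of_not_ge h)
  have h1 := Real.add_one_le_exp (b - a)
  rw [abs_of_nonneg (sub_nonneg.mpr (Real.exp_le_exp.mpr h)), abs_of_nonneg (sub_nonneg.mpr h),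
    max_eq_left (Real.exp_le_exp.mpr h)]
  have h2 : Real.exp b = Real.exp a * Real.exp (b - a) := by rw [← Real.exp_add]; congr 1; ring
  rw [h2]
  nlinarith [Real.exp_pos a]

/-- Logarithmic increments `- j / (v n)`, up to `O(1 / n + j² / n²)`, add up to a Gaussian. -/
theorem exists_eq_exp_of_increments {v C ε n : ℝ} (hv : 0 < v) (hC : 0 ≤ C) (hn : 0 < n)
    {u : ℕ → ℝ} (hu : ∀ j : ℕ, (j : ℝ) + 1 ≤ ε * n → ∃ ρ : ℝ, u (j + 1) = Real.exp ρ * u j ∧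
      |ρ + j / (v * n)| ≤ C * (1 / n + j ^ 2 / n ^ 2)) (j : ℕ) (hj : (j : ℝ) ≤ ε * n) :
    ∃ E : ℝ, u j = u 0 * Real.exp (-(j : ℝ) ^ 2 / (2 * v * n) + E) ∧
      |E| ≤ (C + 1 / (2 * v)) * (j / n + j ^ 3 / n ^ 2) := by
  induction j with
  | zero => exact ⟨0, by simp, by simp⟩
  | succ j ih =>
    push_cast at hj
    obtain ⟨E, hE, hE'⟩ := ih (by linarith)
    obtain ⟨ρ, hρ, hρ'⟩ := hu j hj
    refine ⟨E + (ρ + j / (v * n)) + 1 / (2 * v * n), ?_, ?_⟩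
    · rw [hρ, hE, mul_left_comm, ← Real.exp_add]
      congr 2
      push_cast
      field_simp
      ring
    · have h1 := abs_add_le (E + (ρ + j / (v * n))) (1 / (2 * v * n))
      have h2 := abs_add_le E (ρ + j / (v * n))
      have h3 : |1 / (2 * v * n)| = 1 / (2 * v) * (1 / n) := by
        rw [abs_of_pos (by positivity)]; field_simp
      have h4 : (C + 1 / (2 * v)) * (((j + 1 : ℕ) : ℝ) / n + ((j + 1 : ℕ) : ℝ) ^ 3 / n ^ 2) =
          (C + 1 / (2 * v)) * (j / n + j ^ 3 / n ^ 2) +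
          C * (1 / n + j ^ 2 / n ^ 2) + 1 / (2 * v) * (1 / n) +
          (1 / (2 * v) * (j ^ 2 / n ^ 2) +
            (C + 1 / (2 * v)) * ((2 * j ^ 2 + 3 * j + 1) / n ^ 2)) := by
        push_cast; field_simp; ring
      have h5 : 0 ≤ 1 / (2 * v) * ((j : ℝ) ^ 2 / n ^ 2) +
            (C + 1 / (2 * v)) * ((2 * j ^ 2 + 3 * j + 1) / n ^ 2) := by positivity
      linarith

theorem le_exp_of_increments {C β n : ℝ} (hβ : 0 < β) (hn : 1 ≤ n)
    {u : ℕ → ℝ} (h0 : 0 ≤ u 0)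
    (hu : ∀ j : ℕ, u (j + 1) ≤ Real.exp (C / n - 2 * β * j / n) * u j) (j : ℕ) :
    u j ≤ u 0 * (Real.exp ((C + β) ^ 2 / (2 * β)) * Real.exp (-(β / 2) * (j : ℝ) ^ 2 / n)) := by
  have hn0 : 0 < n := by linarith
  have h1 : u j ≤ u 0 * Real.exp ((C + β) * j / n - β * j ^ 2 / n) := by
    induction j with
    | zero => simp
    | succ j ih =>
      refine (hu j).trans ((mul_le_mul_of_nonneg_left ih (Real.exp_pos _).le).trans_eq ?_)
      rw [mul_left_comm, ← Real.exp_add]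
      congr 2
      push_cast
      field_simp
      ring
  refine h1.trans (mul_le_mul_of_nonneg_left ?_ h0)
  rw [← Real.exp_add]
  apply Real.exp_le_exp.mpr
  have h2 : (C + β) ^ 2 / (2 * β) / n ≤ (C + β) ^ 2 / (2 * β) := div_le_self (by positivity) hn
  have h3 : (C + β) ^ 2 / (2 * β) / n + -(β / 2) * (j : ℝ) ^ 2 / n -
      ((C + β) * j / n - β * j ^ 2 / n) = (C + β - β * j) ^ 2 / (2 * β * n) := by
    field_simp; ring
  have h4 : 0 ≤ (C + β - β * j) ^ 2 / (2 * β * n) := by positivity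
  linarith

/-- A Gaussian approximation with an error that is summable uniformly in `n`: the expansion of
the logarithm serves for `j ≤ ε n`, while beyond both terms are exponentially small in `n`. -/
theorem exists_abs_div_sub_exp_le {v C ε β : ℝ} (hv : 0 < v) (hC : 0 ≤ C) (hε : 0 < ε)
    (hβ : 0 < β) :
    ∃ M c : ℝ, 0 ≤ M ∧ 0 < c ∧ ∀ (n : ℝ) (u : ℕ → ℝ), 1 ≤ n → 0 < u 0 → (∀ j, 0 ≤ u j) →
      (∀ j : ℕ, (j : ℝ) + 1 ≤ ε * n → ∃ ρ : ℝ, u (j + 1) = Real.exp ρ * u j ∧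
        |ρ + j / (v * n)| ≤ C * (1 / n + j ^ 2 / n ^ 2)) →
      (∀ j : ℕ, u (j + 1) ≤ Real.exp (C / n - 2 * β * j / n) * u j) →
      ∀ j : ℕ, |u j / u 0 - Real.exp (-(j : ℝ) ^ 2 / (2 * v * n))| ≤
        M / Real.sqrt n * Real.exp (-c * (j : ℝ) ^ 2 / n) := by
  set c := min (β / 2) (1 / (2 * v)) / 2 with hc
  have hc0 : 0 < c := by positivity
  have hc1 : 2 * c ≤ β / 2 := by rw [hc]; linarith [min_le_left (β / 2) (1 / (2 * v))]
  have hc2 : 2 * c ≤ 1 / (2 * v) := by rw [hc]; linarith [min_le_right (β / 2) (1 / (2 * v))]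
  obtain ⟨D, hD, hDs⟩ := exists_add_pow_three_mul_exp_le hc0
  set B := Real.exp ((C + β) ^ 2 / (2 * β)) with hB
  have hB1 : 1 ≤ B := Real.one_le_exp (by positivity)
  set C1 := C + 1 / (2 * v) with hC1
  have hC1' : 0 ≤ C1 := by positivity
  refine ⟨(C1 + 1 / ε) * B * D, c, by positivity, hc0, ?_⟩
  intro n u hn hu0 hu hinc hle j
  have hn0 : 0 < n := by linarith
  have hsn : 0 < Real.sqrt n := Real.sqrt_pos.mpr hn0
  have hsq : Real.sqrt n ^ 2 = n := Real.sq_sqrt hn0.le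
  set s := (j : ℝ) / Real.sqrt n with hs
  have hs0 : 0 ≤ s := by positivity
  have hs2 : (j : ℝ) ^ 2 / n = s ^ 2 := by rw [hs, div_pow, hsq]
  have ej : -c * (j : ℝ) ^ 2 / n = -c * s ^ 2 := by rw [← hs2]; ring
  have b1 : u j / u 0 ≤ B * Real.exp (-(2 * c) * s ^ 2) := by
    rw [div_le_iff₀' hu0]
    refine (le_exp_of_increments hβ hn hu0.le hle j).trans ?_
    gcongr
    have : -(β / 2) * (j : ℝ) ^ 2 / n = -(β / 2) * s ^ 2 := by rw [← hs2]; ring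
    rw [this]
    nlinarith [sq_nonneg s]
  have b2 : Real.exp (-(j : ℝ) ^ 2 / (2 * v * n)) ≤ B * Real.exp (-(2 * c) * s ^ 2) := by
    calc _ ≤ 1 * Real.exp (-(2 * c) * s ^ 2) := by
          rw [one_mul]
          apply Real.exp_le_exp.mpr
          have : -(j : ℝ) ^ 2 / (2 * v * n) = -(1 / (2 * v)) * s ^ 2 := by
            rw [← hs2]; field_simp
          rw [this]
          nlinarith [sq_nonneg s]
      _ ≤ _ := by gcongr
  have key : |u j / u 0 - Real.exp (-(j : ℝ) ^ 2 / (2 * v * n))| ≤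
      (C1 + 1 / ε) * ((s + s ^ 3) / Real.sqrt n) * (B * Real.exp (-(2 * c) * s ^ 2)) := by
    by_cases hj : (j : ℝ) ≤ ε * n
    · obtain ⟨E, hE, hE'⟩ := exists_eq_exp_of_increments hv hC hn0 hinc j hj
      have e1 : u j / u 0 = Real.exp (-(j : ℝ) ^ 2 / (2 * v * n) + E) := by
        rw [hE]; field_simp
      have e2 := abs_exp_sub_exp_le (-(j : ℝ) ^ 2 / (2 * v * n) + E) (-(j : ℝ) ^ 2 / (2 * v * n))
      rw [add_sub_cancel_left, ← e1] at e2
      have e3 : (j : ℝ) / n + j ^ 3 / n ^ 2 = (s + s ^ 3) / Real.sqrt n := by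
        rw [hs]
        conv_lhs => rw [← hsq]
        field_simp
      rw [e3] at hE'
      refine e2.trans ?_
      have e4 : |E| ≤ (C1 + 1 / ε) * ((s + s ^ 3) / Real.sqrt n) := by
        refine hE'.trans (mul_le_mul_of_nonneg_right ?_ (by positivity))
        have : 0 < 1 / ε := by positivity
        linarith
      exact mul_le_mul e4 (max_le b1 b2) (le_max_of_le_right (Real.exp_pos _).le) (by positivity)
    · have e1 : |u j / u 0 - Real.exp (-(j : ℝ) ^ 2 / (2 * v * n))| ≤
          B * Real.exp (-(2 * c) * s ^ 2) := by
        have := div_nonneg (hu j) hu0.le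
        have := Real.exp_pos (-(j : ℝ) ^ 2 / (2 * v * n))
        rw [abs_le]
        constructor <;> linarith
      refine e1.trans (le_mul_of_one_le_left (by positivity) ?_)
      have e2 : 1 ≤ 1 / ε * (s / Real.sqrt n) := by
        rw [hs, div_div, ← sq, hsq, div_mul_div_comm, one_mul, one_le_div (by positivity)]
        exact (not_le.mp hj).le
      have e3 : 1 / ε * (s / Real.sqrt n) ≤ (C1 + 1 / ε) * ((s + s ^ 3) / Real.sqrt n) := by
        gcongr
        · linarith
        · have : 0 ≤ s ^ 3 := by positivity
          linarith
      exact e2.trans e3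
  refine key.trans ?_
  rw [ej]
  calc _ = (C1 + 1 / ε) * B / Real.sqrt n * ((s + s ^ 3) * Real.exp (-(2 * c) * s ^ 2)) := by ring
    _ ≤ (C1 + 1 / ε) * B / Real.sqrt n * (D * Real.exp (-c * s ^ 2)) :=
      mul_le_mul_of_nonneg_left (hDs s hs0) (by positivity)
    _ = _ := by ring

/-- A probability vector on `ℤ` whose two one-sided ratios to the value at `0` are nearly
Gaussian has there the value `1 / √(2 π v n)` of the Gaussian density, up to a relative error
`O(1 / √n)`. -/
theorem exists_abs_inv_sub_sqrt_le {v C ε β : ℝ} (hv : 0 < v) (hC : 0 ≤ C) (hε : 0 < ε)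
    (hβ : 0 < β) :
    ∃ M n₀ : ℝ, 0 ≤ M ∧ ∀ (n : ℝ) (p : ℤ → ℝ), n₀ ≤ n → 0 < p 0 → (∀ j, 0 ≤ p j) → HasSum p 1 →
      (∀ s : ℤ, s = 1 ∨ s = -1 → ∀ j : ℕ, (j : ℝ) + 1 ≤ ε * n →
        ∃ ρ : ℝ, p (s * (j + 1 : ℕ)) = Real.exp ρ * p (s * j) ∧
        |ρ + j / (v * n)| ≤ C * (1 / n + j ^ 2 / n ^ 2)) →
      (∀ s : ℤ, s = 1 ∨ s = -1 → ∀ j : ℕ,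
        p (s * (j + 1 : ℕ)) ≤ Real.exp (C / n - 2 * β * j / n) * p (s * j)) →
      |1 / p 0 - Real.sqrt (2 * Real.pi * v * n)| ≤ M := by
  obtain ⟨M1, c, hM1, hc, hgauss⟩ := exists_abs_div_sub_exp_le hv hC hε hβ
  obtain ⟨M2, hM2, htheta⟩ := exists_abs_tsum_exp_sub_sqrt_le
  have hpi := Real.pi_pos
  refine ⟨M1 * (M2 + Real.sqrt (Real.pi / c)) + M2, max 1 (max (1 / (2 * v)) c),
    by positivity, ?_⟩
  intro n p hn hp0 hp hsum hinc hle
  have hn1 : 1 ≤ n := (le_max_left _ _).trans hn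
  have hnv : 1 / (2 * v) ≤ n := ((le_max_left _ _).trans (le_max_right _ _)).trans hn
  have hnc : c ≤ n := ((le_max_right _ _).trans (le_max_right _ _)).trans hn
  have hn0 : 0 < n := by linarith
  have hsn : 1 ≤ Real.sqrt n := Real.one_le_sqrt.mpr hn1
  have hsn0 : 0 < Real.sqrt n := by linarith
  have main : ∀ j : ℤ, |p j / p 0 - Real.exp (-(1 / (2 * v * n)) * (j : ℝ) ^ 2)| ≤
      M1 / Real.sqrt n * Real.exp (-(c / n) * (j : ℝ) ^ 2) := by
    intro j
    obtain ⟨s, m, hs, rfl⟩ : ∃ (s : ℤ) (m : ℕ), (s = 1 ∨ s = -1) ∧ j = s * m := by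
      obtain ⟨m, rfl | rfl⟩ := Int.eq_nat_or_neg j
      · exact ⟨1, m, Or.inl rfl, by simp⟩
      · exact ⟨-1, m, Or.inr rfl, by simp⟩
    have h1 := hgauss n (fun m : ℕ => p (s * m)) hn1 (by simpa using hp0) (fun _ => hp _)
      (hinc s hs) (hle s hs) m
    have h2 : (((s * m : ℤ)) : ℝ) ^ 2 = (m : ℝ) ^ 2 := by
      rcases hs with rfl | rfl <;> simp
    rw [h2]
    simp only [Nat.cast_zero, mul_zero] at h1
    have h3 : -(m : ℝ) ^ 2 / (2 * v * n) = -(1 / (2 * v * n)) * (m : ℝ) ^ 2 := by ring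
    have h4 : -c * (m : ℝ) ^ 2 / n = -(c / n) * (m : ℝ) ^ 2 := by ring
    rwa [h3, h4] at h1
  have s1 := summable_exp_neg_mul_int_sq (a := 1 / (2 * v * n)) (by positivity)
  have s2 := summable_exp_neg_mul_int_sq (a := c / n) (by positivity)
  have t1 := htheta (1 / (2 * v * n)) (by positivity) (by
    rw [div_le_iff₀ (by positivity)]
    rw [div_le_iff₀ (by positivity)] at hnv
    nlinarith [Real.pi_gt_three])
  have t2 := htheta (c / n) (by positivity) (by
    rw [div_le_iff₀ hn0]
    nlinarith [Real.pi_gt_three])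
  have hp' : HasSum (fun j => p j / p 0) (1 / p 0) := hsum.div_const _
  have d1 : |1 / p 0 - ∑' j : ℤ, Real.exp (-(1 / (2 * v * n)) * (j : ℝ) ^ 2)| ≤
      M1 / Real.sqrt n * ∑' j : ℤ, Real.exp (-(c / n) * (j : ℝ) ^ 2) := by
    rw [← hp'.tsum_eq, ← hp'.summable.tsum_sub s1, ← tsum_mul_left, ← Real.norm_eq_abs]
    exact tsum_of_norm_bounded (s2.mul_left _).hasSum main
  have d2 : ∑' j : ℤ, Real.exp (-(c / n) * (j : ℝ) ^ 2) ≤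
      (M2 + Real.sqrt (Real.pi / c)) * Real.sqrt n := by
    have h1 : Real.sqrt (Real.pi / (c / n)) = Real.sqrt (Real.pi / c) * Real.sqrt n := by
      rw [← Real.sqrt_mul (by positivity)]; congr 1; field_simp
    rw [h1] at t2
    have h2 := (abs_le.mp t2).2
    nlinarith
  have d3 : M1 / Real.sqrt n * ∑' j : ℤ, Real.exp (-(c / n) * (j : ℝ) ^ 2) ≤
      M1 * (M2 + Real.sqrt (Real.pi / c)) := by
    calc _ ≤ M1 / Real.sqrt n * ((M2 + Real.sqrt (Real.pi / c)) * Real.sqrt n) := by gcongr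
      _ = _ := by field_simp
  have h1 : Real.pi / (1 / (2 * v * n)) = 2 * Real.pi * v * n := by field_simp
  rw [h1] at t1
  calc _ ≤ _ := abs_sub_le _ _ _
    _ ≤ _ := add_le_add (d1.trans d3) t1

/-! ### The limit shape -/

/-- The function `u ↦ log (1 - e ^ (-u))`, the logarithm of a factor `1 - q ^ m` at
`u = -m log q`. -/
noncomputable def logOneSubExp (u : ℝ) : ℝ := Real.log (1 - Real.exp (-u))

theorem one_sub_exp_neg_pos {u : ℝ} (hu : 0 < u) : 0 < 1 - Real.exp (-u) :=
  sub_pos.mpr (Real.exp_lt_one_iff.mpr (neg_lt_zero.mpr hu))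

theorem exp_logOneSubExp {u : ℝ} (hu : 0 < u) :
    Real.exp (logOneSubExp u) = 1 - Real.exp (-u) :=
  Real.exp_log (one_sub_exp_neg_pos hu)

section LimitShape

variable {β x y : ℝ}

theorem exp_neg_mul_mem_Ioo (hβ : 0 < β) (hx : x ∈ Set.Ioo (0 : ℝ) 1) :
    Real.exp (-β) < Real.exp (-β * x) ∧ Real.exp (-β * x) < 1 := by
  obtain ⟨h0, h1⟩ := hx
  constructor
  · apply Real.exp_lt_exp.mpr; nlinarith
  · apply Real.exp_lt_one_iff.mpr; nlinarith

theorem exp_neg_mul_h (hβ : 0 < β) (hx : x ∈ Set.Ioo (0 : ℝ) 1) (hy : y ∈ Set.Ioo (0 : ℝ) 1) :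
    Real.exp (-β * h β x y) * (1 - Real.exp (-β)) =
      Real.exp (-β * x) + Real.exp (-β * y) - Real.exp (-β * x) * Real.exp (-β * y) -
        Real.exp (-β) := by
  obtain ⟨hX, hX1⟩ := exp_neg_mul_mem_Ioo hβ hx
  obtain ⟨hY, hY1⟩ := exp_neg_mul_mem_Ioo hβ hy
  have hE := Real.exp_pos (-β)
  have e1 : Real.exp (-β * (x + y)) = Real.exp (-β * x) * Real.exp (-β * y) := by
    rw [mul_add, Real.exp_add]
  have hpos : 0 < Real.exp (-β * x) + Real.exp (-β * y) -
      Real.exp (-β * x) * Real.exp (-β * y) - Real.exp (-β) := by nlinarith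
  have h1 : 0 < 1 - Real.exp (-β) := one_sub_exp_neg_pos hβ
  have e2 : -β * h β x y = Real.log (Real.exp (-β * x) + Real.exp (-β * y) -
      Real.exp (-β * x) * Real.exp (-β * y) - Real.exp (-β)) - Real.log (1 - Real.exp (-β)) := by
    unfold h
    rw [e1]
    field_simp
    ring
  rw [e2, Real.exp_sub, Real.exp_log hpos, Real.exp_log h1]
  field_simp

theorem h_pos (hβ : 0 < β) (hx : x ∈ Set.Ioo (0 : ℝ) 1) (hy : y ∈ Set.Ioo (0 : ℝ) 1) :
    0 < h β x y := by
  obtain ⟨hX, hX1⟩ := exp_neg_mul_mem_Ioo hβ hx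
  obtain ⟨hY, hY1⟩ := exp_neg_mul_mem_Ioo hβ hy
  have hT := exp_neg_mul_h hβ hx hy
  have : Real.exp (-β * h β x y) < 1 := by
    by_contra! hcon
    nlinarith [mul_pos (sub_pos.mpr hX1) (sub_pos.mpr hY1)]
  rw [Real.exp_lt_one_iff] at this
  nlinarith

theorem h_comm : h β x y = h β y x := by
  unfold h
  rw [add_comm (Real.exp (-β * x)), add_comm x y]

theorem h_lt_left (hβ : 0 < β) (hx : x ∈ Set.Ioo (0 : ℝ) 1) (hy : y ∈ Set.Ioo (0 : ℝ) 1) :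
    h β x y < x := by
  obtain ⟨hX, hX1⟩ := exp_neg_mul_mem_Ioo hβ hx
  obtain ⟨hY, hY1⟩ := exp_neg_mul_mem_Ioo hβ hy
  have hT := exp_neg_mul_h hβ hx hy
  have : Real.exp (-β * x) < Real.exp (-β * h β x y) := by
    by_contra! hcon
    nlinarith [mul_pos (sub_pos.mpr hX1) (sub_pos.mpr hY)]
  rw [Real.exp_lt_exp] at this
  nlinarith

theorem h_lt_right (hβ : 0 < β) (hx : x ∈ Set.Ioo (0 : ℝ) 1) (hy : y ∈ Set.Ioo (0 : ℝ) 1) :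
    h β x y < y := by
  rw [h_comm]; exact h_lt_left hβ hy hx

theorem one_sub_sub_add_h_pos (hβ : 0 < β) (hx : x ∈ Set.Ioo (0 : ℝ) 1)
    (hy : y ∈ Set.Ioo (0 : ℝ) 1) : 0 < 1 - x - y + h β x y := by
  obtain ⟨hX, hX1⟩ := exp_neg_mul_mem_Ioo hβ hx
  obtain ⟨hY, hY1⟩ := exp_neg_mul_mem_Ioo hβ hy
  have hT := exp_neg_mul_h hβ hx hy
  have hE := Real.exp_pos (-β)
  have : Real.exp (-β) * Real.exp (-β * h β x y) < Real.exp (-β * x) * Real.exp (-β * y) := by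
    by_contra! hcon
    nlinarith [mul_pos (sub_pos.mpr hX) (sub_pos.mpr hY)]
  rw [← Real.exp_add, ← Real.exp_add, Real.exp_lt_exp] at this
  nlinarith

/-- At the limit shape the odds of consecutive heights are even. -/
theorem log_odds_h_eq_zero (hβ : 0 < β) (hx : x ∈ Set.Ioo (0 : ℝ) 1)
    (hy : y ∈ Set.Ioo (0 : ℝ) 1) :
    β * (x + y - 2 * h β x y) + logOneSubExp (β * (x - h β x y)) +
      logOneSubExp (β * (y - h β x y)) - logOneSubExp (β * h β x y) -
        logOneSubExp (β * (1 - x - y + h β x y)) = 0 := by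
  have hT := exp_neg_mul_h hβ hx hy
  have h1 := mul_pos hβ (sub_pos.mpr (h_lt_left hβ hx hy))
  have h2 := mul_pos hβ (sub_pos.mpr (h_lt_right hβ hx hy))
  have h3 := mul_pos hβ (h_pos hβ hx hy)
  have h4 := mul_pos hβ (one_sub_sub_add_h_pos hβ hx hy)
  have p1 := one_sub_exp_neg_pos h1
  have p2 := one_sub_exp_neg_pos h2
  have p3 := one_sub_exp_neg_pos h3
  have p4 := one_sub_exp_neg_pos h4
  set t := h β x y
  unfold logOneSubExp
  rw [← Real.log_exp (β * (x + y - 2 * t)), ← Real.log_mul (Real.exp_pos _).ne' p1.ne',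
    ← Real.log_mul (mul_pos (Real.exp_pos _) p1).ne' p2.ne', sub_sub,
    ← Real.log_mul p3.ne' p4.ne', sub_eq_zero]
  congr 1
  have e0 : Real.exp (β * (x + y - 2 * t)) =
      Real.exp (-β * t) ^ 2 / (Real.exp (-β * x) * Real.exp (-β * y)) := by
    rw [sq, ← Real.exp_add, ← Real.exp_add, ← Real.exp_sub]; congr 1; ring
  have e1 : Real.exp (-(β * (x - t))) = Real.exp (-β * x) / Real.exp (-β * t) := by
    rw [← Real.exp_sub]; congr 1; ring
  have e2 : Real.exp (-(β * (y - t))) = Real.exp (-β * y) / Real.exp (-β * t) := by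
    rw [← Real.exp_sub]; congr 1; ring
  have e3 : Real.exp (-(β * t)) = Real.exp (-β * t) := by rw [neg_mul]
  have e4 : Real.exp (-(β * (1 - x - y + t))) = Real.exp (-β) * Real.exp (-β * t) /
      (Real.exp (-β * x) * Real.exp (-β * y)) := by
    rw [← Real.exp_add, ← Real.exp_add, ← Real.exp_sub]; congr 1; ring
  rw [e0, e1, e2, e3, e4]
  have hX := Real.exp_pos (-β * x)
  have hY := Real.exp_pos (-β * y)
  have hTp := Real.exp_pos (-β * t)
  generalize Real.exp (-β * x) = X at *
  generalize Real.exp (-β * y) = Y at *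
  generalize Real.exp (-β * t) = T at *
  field_simp
  linear_combination T * hT

theorem exp_two_mul_d (hβ : 0 < β) (hx : x ∈ Set.Ioo (0 : ℝ) 1) (hy : y ∈ Set.Ioo (0 : ℝ) 1) :
    Real.exp (2 * d β x y) = (1 - Real.exp (-β)) /
      ((1 - Real.exp (-(β * (x - h β x y)))) * (1 - Real.exp (-(β * (y - h β x y))))) := by
  have p0 := one_sub_exp_neg_pos hβ
  have p1 := one_sub_exp_neg_pos (mul_pos hβ (sub_pos.mpr (h_lt_left hβ hx hy)))
  have p2 := one_sub_exp_neg_pos (mul_pos hβ (sub_pos.mpr (h_lt_right hβ hx hy)))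
  have e : 2 * d β x y = Real.log (1 - Real.exp (-β)) -
      Real.log (1 - Real.exp (-(β * (x - h β x y)))) -
      Real.log (1 - Real.exp (-(β * (y - h β x y)))) := by
    unfold d
    simp only [neg_mul]
    ring
  rw [e, Real.exp_sub, Real.exp_sub, Real.exp_log p0, Real.exp_log p1, Real.exp_log p2, div_div]

/-- The derivative of the log-odds at the limit shape is `-β e ^ (2 d)`. -/
theorem exp_two_mul_d_eq_sum (hβ : 0 < β) (hx : x ∈ Set.Ioo (0 : ℝ) 1)
    (hy : y ∈ Set.Ioo (0 : ℝ) 1) :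
    Real.exp (2 * d β x y) = 2 + (Real.exp (β * (x - h β x y)) - 1)⁻¹ +
      (Real.exp (β * (y - h β x y)) - 1)⁻¹ + (Real.exp (β * h β x y) - 1)⁻¹ +
        (Real.exp (β * (1 - x - y + h β x y)) - 1)⁻¹ := by
  obtain ⟨hX, hX1⟩ := exp_neg_mul_mem_Ioo hβ hx
  obtain ⟨hY, hY1⟩ := exp_neg_mul_mem_Ioo hβ hy
  rw [exp_two_mul_d hβ hx hy]
  have hT := exp_neg_mul_h hβ hx hy
  set t := h β x y
  have hXp := Real.exp_pos (-β * x)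
  have hYp := Real.exp_pos (-β * y)
  have hTp := Real.exp_pos (-β * t)
  have hEp := Real.exp_pos (-β)
  have e1 : Real.exp (-(β * (x - t))) = Real.exp (-β * x) / Real.exp (-β * t) := by
    rw [← Real.exp_sub]; congr 1; ring
  have e2 : Real.exp (-(β * (y - t))) = Real.exp (-β * y) / Real.exp (-β * t) := by
    rw [← Real.exp_sub]; congr 1; ring
  have f1 : Real.exp (β * (x - t)) = Real.exp (-β * t) / Real.exp (-β * x) := by
    rw [← Real.exp_sub]; congr 1; ring
  have f2 : Real.exp (β * (y - t)) = Real.exp (-β * t) / Real.exp (-β * y) := by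
    rw [← Real.exp_sub]; congr 1; ring
  have f3 : Real.exp (β * t) = 1 / Real.exp (-β * t) := by
    rw [one_div, ← Real.exp_neg]; congr 1; ring
  have f4 : Real.exp (β * (1 - x - y + t)) = Real.exp (-β * x) * Real.exp (-β * y) /
      (Real.exp (-β) * Real.exp (-β * t)) := by
    rw [← Real.exp_add, ← Real.exp_add, ← Real.exp_sub]; congr 1; ring
  rw [e1, e2, f1, f2, f3, f4]
  generalize Real.exp (-β * x) = X at *
  generalize Real.exp (-β * y) = Y at *
  generalize Real.exp (-β) = E at *
  have hE1 : 0 < 1 - E := by linarith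
  have hT' : Real.exp (-β * t) = (X + Y - X * Y - E) / (1 - E) := by
    rw [eq_div_iff hE1.ne', hT]
  generalize Real.exp (-β * t) = T at *
  -- each of the four differences factors in terms of `1 - X`, `1 - Y`, `X - E`, `Y - E`
  have g1 : T - X = (1 - X) * (Y - E) / (1 - E) := by rw [hT']; field_simp; ring
  have g2 : T - Y = (1 - Y) * (X - E) / (1 - E) := by rw [hT']; field_simp; ring
  have g3 : 1 - T = (1 - X) * (1 - Y) / (1 - E) := by rw [hT']; field_simp; ring
  have g4 : X * Y - E * T = (X - E) * (Y - E) / (1 - E) := by rw [hT']; field_simp; ring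
  have a1 : 1 - X / T = (1 - X) * (Y - E) / ((1 - E) * T) := by
    rw [← div_div, ← g1]; field_simp
  have a2 : 1 - Y / T = (1 - Y) * (X - E) / ((1 - E) * T) := by
    rw [← div_div, ← g2]; field_simp
  have b1 : (T / X - 1)⁻¹ = X * (1 - E) / ((1 - X) * (Y - E)) := by
    rw [show T / X - 1 = (T - X) / X by field_simp, g1, inv_div]
    field_simp
  have b2 : (T / Y - 1)⁻¹ = Y * (1 - E) / ((1 - Y) * (X - E)) := by
    rw [show T / Y - 1 = (T - Y) / Y by field_simp, g2, inv_div]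
    field_simp
  have b3 : (1 / T - 1)⁻¹ = T * (1 - E) / ((1 - X) * (1 - Y)) := by
    rw [show 1 / T - 1 = (1 - T) / T by field_simp, g3, inv_div]
    field_simp
  have b4 : (X * Y / (E * T) - 1)⁻¹ = E * T * (1 - E) / ((X - E) * (Y - E)) := by
    rw [show X * Y / (E * T) - 1 = (X * Y - E * T) / (E * T) by field_simp, g4, inv_div]
    field_simp
  rw [a1, a2, b1, b2, b3, b4]
  have c1 : 0 < 1 - X := by linarith
  have c2 : 0 < 1 - Y := by linarith
  have c3 : 0 < X - E := by linarith
  have c4 : 0 < Y - E := by linarith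
  have : (1 - E) / ((1 - X) * (Y - E) / ((1 - E) * T) * ((1 - Y) * (X - E) / ((1 - E) * T))) =
      (1 - E) ^ 3 * T ^ 2 / ((1 - X) * (Y - E) * ((1 - Y) * (X - E))) := by field_simp
  rw [this, hT']
  field_simp
  ring

end LimitShape

/-! ### Odds of consecutive heights -/

/-- A second-order Taylor bound near `u₀`, from the elementary bounds on `exp` and `log`. -/
theorem exists_abs_logOneSubExp_sub_le {u₀ : ℝ} (hu₀ : 0 < u₀) :
    ∃ η M : ℝ, 0 < η ∧ 0 ≤ M ∧ ∀ u : ℝ, |u - u₀| ≤ η → 0 < u ∧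
      |logOneSubExp u - logOneSubExp u₀ - (Real.exp u₀ - 1)⁻¹ * (u - u₀)| ≤ M * (u - u₀) ^ 2 := by
  set a := (Real.exp u₀ - 1)⁻¹ with ha
  have hE : 0 < Real.exp u₀ - 1 := sub_pos.mpr (Real.one_lt_exp_iff.mpr hu₀)
  have ha0 : 0 < a := inv_pos.mpr hE
  refine ⟨min (u₀ / 2) (min 1 (1 / (4 * a))), a + 8 * a ^ 2, by positivity, by positivity,
    fun u hu => ?_⟩
  have h1 : |u - u₀| ≤ u₀ / 2 := hu.trans (min_le_left _ _)
  have h2 : |u - u₀| ≤ 1 := hu.trans ((min_le_right _ _).trans (min_le_left _ _))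
  have h3 : |u - u₀| ≤ 1 / (4 * a) := hu.trans ((min_le_right _ _).trans (min_le_right _ _))
  have hu0 : 0 < u := by linarith [(abs_le.mp h1).1]
  refine ⟨hu0, ?_⟩
  set t := u - u₀ with ht
  have p := one_sub_exp_neg_pos hu0
  have p₀ := one_sub_exp_neg_pos hu₀
  set w := a * (1 - Real.exp (-t)) with hw
  have hz : (1 - Real.exp (-u)) / (1 - Real.exp (-u₀)) = 1 + w := by
    have e1 : Real.exp (-u) = Real.exp (-u₀) * Real.exp (-t) := by
      rw [← Real.exp_add]; congr 1; rw [ht]; ring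
    rw [hw, ha, e1]
    rw [Real.exp_neg u₀] at p₀ ⊢
    have := Real.exp_pos u₀
    have h5 : 1 - (Real.exp u₀)⁻¹ = (Real.exp u₀ - 1) / Real.exp u₀ := by field_simp
    rw [h5]
    field_simp
    ring
  have hw1 : |w - a * t| ≤ a * t ^ 2 := by
    have := Real.abs_exp_sub_one_sub_id_le (x := -t) (by rwa [abs_neg])
    rw [neg_sq] at this
    have e : w - a * t = -(a * (Real.exp (-t) - 1 - -t)) := by rw [hw]; ring
    rw [e, abs_neg, abs_mul, abs_of_pos ha0]
    gcongr
  have hw2 : |w| ≤ 2 * a * |t| := by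
    have := Real.abs_exp_sub_one_le (x := -t) (by rwa [abs_neg])
    rw [abs_neg] at this
    rw [hw, abs_mul, abs_of_pos ha0, abs_sub_comm]
    nlinarith
  have hw3 : |w| ≤ 1 / 2 := by
    have : 2 * a * |t| ≤ 2 * a * (1 / (4 * a)) := by gcongr
    have e : 2 * a * (1 / (4 * a)) = 1 / 2 := by field_simp; norm_num
    linarith
  have hlog : |Real.log (1 + w) - w| ≤ 2 * w ^ 2 := by
    have hpos : 0 < 1 + w := by linarith [(abs_le.mp hw3).1]
    have l1 := Real.log_le_sub_one_of_pos hpos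
    have l2 := Real.one_sub_inv_le_log_of_pos hpos
    have l3 : 1 - (1 + w)⁻¹ - w = -(w ^ 2 / (1 + w)) := by field_simp; ring
    have l4 : w ^ 2 / (1 + w) ≤ 2 * w ^ 2 := by
      rw [div_le_iff₀ hpos]
      nlinarith [sq_nonneg w, (abs_le.mp hw3).1]
    rw [abs_le]
    constructor
    · linarith
    · nlinarith [sq_nonneg w]
  have hw4 : 2 * w ^ 2 ≤ 8 * a ^ 2 * t ^ 2 := by
    have := mul_self_le_mul_self (abs_nonneg w) hw2
    rw [abs_mul_abs_self] at this
    have e : 2 * a * |t| * (2 * a * |t|) = 4 * a ^ 2 * t ^ 2 := by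
      rw [← sq_abs t]; ring
    nlinarith
  have e : logOneSubExp u - logOneSubExp u₀ = Real.log (1 + w) := by
    rw [← hz, Real.log_div p.ne' p₀.ne']; rfl
  rw [e]
  calc _ ≤ |Real.log (1 + w) - w| + |w - a * t| := abs_sub_le _ _ _
    _ ≤ 8 * a ^ 2 * t ^ 2 + a * t ^ 2 := add_le_add (hlog.trans hw4) hw1
    _ = _ := by ring

/-- If `lam ≈ β / n` and `z ≈ w n + s i`, then `lam z` is `β w + β s i / n` up to
`O(1 / n)`. -/
theorem abs_mul_sub_le {β B w s n lam z i : ℝ} (hβ : 0 < β) (hB : 0 ≤ B) (hw : |w| ≤ 3)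
    (hs : |s| ≤ 2) (hn : 1 ≤ n) (hlam : |lam * n - β| ≤ B / n) (hz : |z - (w * n + s * i)| ≤ 3)
    (hi : |i| ≤ n) : |lam * z - β * w - β * s * i / n| ≤ (8 * B + 3 * β) / n := by
  have hn0 : 0 < n := by linarith
  have e : lam * z - β * w - β * s * i / n =
      (lam * n - β) * (z / n) + β * ((z - (w * n + s * i)) / n) := by field_simp; ring
  have hzn : |z / n| ≤ 8 := by
    rw [abs_div, abs_of_pos hn0, div_le_iff₀ hn0]
    have h1 : |w * n| ≤ 3 * n := by rw [abs_mul, abs_of_pos hn0]; gcongr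
    have h2 : |s * i| ≤ 2 * n := by rw [abs_mul]; gcongr
    have h3 : z = z - (w * n + s * i) + (w * n + s * i) := by ring
    rw [h3]
    refine (abs_add_le _ _).trans ?_
    have := abs_add_le (w * n) (s * i)
    linarith
  rw [e]
  refine (abs_add_le _ _).trans ?_
  have hz3 : |(z - (w * n + s * i)) / n| ≤ 3 / n := by
    rw [abs_div, abs_of_pos hn0]; gcongr
  rw [abs_mul, abs_mul, abs_of_pos hβ]
  calc _ ≤ B / n * 8 + β * (3 / n) := by gcongr
    _ = _ := by ring

/-- The first-order expansion in `i / n` of one factor `1 - q ^ z` of the odds, where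
`q = e ^ (-lam)` and `z ≈ w n + s i`. -/
theorem exists_abs_logOneSubExp_mul_sub_le {β B w s : ℝ} (hβ : 0 < β) (hB : 0 ≤ B) (hw : 0 < w)
    (hw3 : w ≤ 3) (hs : |s| = 1) :
    ∃ ε C n₀ : ℝ, 0 < ε ∧ 0 ≤ C ∧ ∀ n lam z i : ℝ, n₀ ≤ n → |lam * n - β| ≤ B / n →
      |z - (w * n + s * i)| ≤ 3 → |i| ≤ ε * n → 0 < lam * z ∧
      |logOneSubExp (lam * z) - logOneSubExp (β * w) -
        (Real.exp (β * w) - 1)⁻¹ * (β * s * i / n)| ≤ C * (1 / n + i ^ 2 / n ^ 2) := by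
  obtain ⟨η, M, hη, hM, htaylor⟩ := exists_abs_logOneSubExp_sub_le (mul_pos hβ hw)
  set a := (Real.exp (β * w) - 1)⁻¹ with ha
  have ha0 : 0 < a := inv_pos.mpr (sub_pos.mpr (Real.one_lt_exp_iff.mpr (mul_pos hβ hw)))
  set B' := 8 * B + 3 * β with hB'
  have hB'0 : 0 < B' := by positivity
  refine ⟨min 1 (η / (2 * β)), a * B' + M * (2 * β ^ 2 + 2 * B' ^ 2), max 1 (2 * B' / η),
    by positivity, by positivity, ?_⟩
  intro n lam z i hn hlam hz hi
  have hn1 : 1 ≤ n := (le_max_left _ _).trans hn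
  have hn2 : 2 * B' / η ≤ n := (le_max_right _ _).trans hn
  have hn0 : 0 < n := by linarith
  have hi1 : |i| ≤ n := hi.trans (by
    calc _ ≤ 1 * n := by gcongr; exact min_le_left _ _
      _ = n := one_mul n)
  have hi2 : |i| ≤ η / (2 * β) * n := hi.trans (by gcongr; exact min_le_right _ _)
  have hδ := abs_mul_sub_le hβ hB (by rwa [abs_of_pos hw]) (by rw [hs]; norm_num) hn1 hlam hz hi1
  rw [← hB'] at hδ
  set δ := lam * z - β * w - β * s * i / n with hδd
  have e : lam * z - β * w = β * s * i / n + δ := by rw [hδd]; ring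
  have h1 : |β * s * i / n| = β * (|i| / n) := by
    rw [abs_div, abs_mul, abs_mul, hs, abs_of_pos hβ, abs_of_pos hn0]; ring
  have h2 : |lam * z - β * w| ≤ η := by
    rw [e]
    refine (abs_add_le _ _).trans ?_
    rw [h1]
    have h3 : β * (|i| / n) ≤ η / 2 := by
      calc _ ≤ β * (η / (2 * β) * n / n) := by gcongr
        _ = η / 2 := by field_simp
    have h4 : B' / n ≤ η / 2 := by
      rw [div_le_iff₀ hn0]
      rw [div_le_iff₀ hη] at hn2
      linarith
    linarith
  obtain ⟨hpos, hbound⟩ := htaylor (lam * z) h2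
  refine ⟨hpos, ?_⟩
  have h5 : (lam * z - β * w) ^ 2 ≤ (2 * β ^ 2 + 2 * B' ^ 2) * (1 / n + i ^ 2 / n ^ 2) := by
    have h6 : (β * s * i / n) ^ 2 = β ^ 2 * (i ^ 2 / n ^ 2) := by
      rw [← sq_abs, h1, mul_pow, div_pow, sq_abs]
    have h7 : δ ^ 2 ≤ B' ^ 2 * (1 / n) := by
      have h8 : δ ^ 2 ≤ (B' / n) ^ 2 := by rw [← sq_abs]; gcongr
      have h9 : (B' / n) ^ 2 ≤ B' ^ 2 * (1 / n) := by
        rw [div_pow, mul_one_div]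
        gcongr
        nlinarith
      linarith
    have h8 : (β * s * i / n + δ) ^ 2 ≤ 2 * (β * s * i / n) ^ 2 + 2 * δ ^ 2 := by
      nlinarith [sq_nonneg (β * s * i / n - δ)]
    rw [e]
    have h9 : (2 * β ^ 2 + 2 * B' ^ 2) * (1 / n + i ^ 2 / n ^ 2) =
        2 * (β ^ 2 * (i ^ 2 / n ^ 2)) + 2 * (B' ^ 2 * (1 / n)) +
          (2 * β ^ 2 * (1 / n) + 2 * B' ^ 2 * (i ^ 2 / n ^ 2)) := by ring
    have h10 : 0 ≤ 2 * β ^ 2 * (1 / n) + 2 * B' ^ 2 * (i ^ 2 / n ^ 2) := by positivity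
    linarith
  have e2 : logOneSubExp (lam * z) - logOneSubExp (β * w) - a * (β * s * i / n) =
      (logOneSubExp (lam * z) - logOneSubExp (β * w) - a * (lam * z - β * w)) + a * δ := by
    rw [e]; ring
  rw [e2]
  refine (abs_add_le _ _).trans ?_
  rw [abs_mul, abs_of_pos ha0]
  calc _ ≤ M * ((2 * β ^ 2 + 2 * B' ^ 2) * (1 / n + i ^ 2 / n ^ 2)) + a * (B' / n) := by
        gcongr
        exact hbound.trans (by gcongr)
    _ ≤ M * ((2 * β ^ 2 + 2 * B' ^ 2) * (1 / n + i ^ 2 / n ^ 2)) +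
        a * (B' * (1 / n + i ^ 2 / n ^ 2)) := by
        gcongr
        rw [div_eq_mul_one_div B' n]
        gcongr
        have : 0 ≤ i ^ 2 / n ^ 2 := by positivity
        linarith
    _ = _ := by ring

theorem abs_neg_log_one_sub_div_mul_sub_le {β n : ℝ} (hβ : 0 < β) (hn : 2 * β ≤ n) :
    |-Real.log (1 - β / n) * n - β| ≤ 2 * β ^ 2 / n := by
  have hn0 : 0 < n := by linarith
  have h1 : β / n ≤ 1 / 2 := by rw [div_le_iff₀ hn0]; linarith
  have hpos : 0 < 1 - β / n := by linarith
  have l1 := Real.log_le_sub_one_of_pos hpos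
  have l2 := Real.one_sub_inv_le_log_of_pos hpos
  have e1 : (1 - β / n)⁻¹ ≤ 1 + β / n + 2 * (β / n) ^ 2 := by
    rw [inv_le_iff_one_le_mul₀ hpos]
    have : 0 ≤ β / n := by positivity
    nlinarith [mul_nonneg (sq_nonneg (β / n)) (sub_nonneg.mpr h1)]
  have h2 : -Real.log (1 - β / n) ≤ β / n + 2 * (β / n) ^ 2 := by linarith
  have h3 : β / n ≤ -Real.log (1 - β / n) := by linarith
  have h4 : β / n * n = β := by field_simp
  have h5 : (β / n + 2 * (β / n) ^ 2) * n = β + 2 * β ^ 2 / n := by field_simp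
  have h6 := mul_le_mul_of_nonneg_right h2 hn0.le
  have h7 := mul_le_mul_of_nonneg_right h3 hn0.le
  rw [abs_le]
  have : 0 ≤ 2 * β ^ 2 / n := by positivity
  constructor <;> linarith

/-- The probability, under the Mallows measure, that the height function takes the value `k`. -/
noncomputable def heightProb (N : ℕ) (q : ℝ) (L K : ℕ) (k : ℤ) : ℝ :=
  prob N q {w | (height L K w : ℤ) = k}

theorem heightProb_nonneg (N : ℕ) {q : ℝ} (hq : 0 ≤ q) (L K : ℕ) (k : ℤ) :
    0 ≤ heightProb N q L K k :=
  prob_height_nonneg N hq L K k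

theorem hasSum_heightProb_add (N : ℕ) {q : ℝ} (hq : 0 ≤ q) (L K : ℕ) (c : ℤ) :
    HasSum (fun j : ℤ => heightProb N q L K (c + j)) 1 := by
  have h1 : HasSum (heightProb N q L K) 1 := hasSum_prob_height N hq L K
  rw [← (Equiv.addLeft c).hasSum_iff] at h1
  exact h1

theorem zpow_eq_exp {q : ℝ} (hq : 0 < q) (z : ℤ) :
    q ^ z = Real.exp (-(-Real.log q * z)) := by
  rw [← Real.rpow_intCast, Real.rpow_def_of_pos hq]
  congr 1; ring

/-- A strong form of log-concavity: each step lowers the odds of consecutive heights by a factor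
of at least `q²`, because of the power of `q` in the `q`-hypergeometric law. -/
theorem heightProb_mul_le {N : ℕ} {q : ℝ} (hq : 0 < q) (hq1 : q < 1) {L K : ℕ} (hL : L ≤ N)
    (hK : K ≤ N) (k : ℤ) (m : ℕ) :
    heightProb N q L K (k + m + 1) * heightProb N q L K k ≤
      q ^ (2 * m) * (heightProb N q L K (k + m) * heightProb N q L K (k + 1)) := by
  have nn : ∀ j, 0 ≤ heightProb N q L K j := heightProb_nonneg N hq.le L K
  have hrhs : 0 ≤ q ^ (2 * m) * (heightProb N q L K (k + m) * heightProb N q L K (k + 1)) :=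
    mul_nonneg (pow_nonneg hq.le _) (mul_nonneg (nn _) (nn _))
  by_cases hk : k < 0 ∨ k < L + K - N
  · have : heightProb N q L K k = 0 :=
      prob_height_eq_zero q hL hK (by omega)
    rw [this, mul_zero]
    exact hrhs
  by_cases hk' : (L : ℤ) ≤ k + m ∨ (K : ℤ) ≤ k + m
  · have : heightProb N q L K (k + m + 1) = 0 :=
      prob_height_eq_zero q hL hK (by omega)
    rw [this, zero_mul]
    exact hrhs
  push Not at hk hk'
  have r1 := prob_height_succ_mul hq (L := L) (K := K) (N := N) (k := k)
    (by omega) (by omega) (by omega) (by omega)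
  have r2 := prob_height_succ_mul hq (L := L) (K := K) (N := N) (k := k + m)
    (by omega) (by omega) (by omega) (by omega)
  have mono : ∀ s t : ℤ, s ≤ t → 1 - q ^ s ≤ 1 - q ^ t := fun s t hst =>
    sub_le_sub_left (zpow_le_zpow_right_of_le_one₀ hq hq1.le hst) 1
  have pos : ∀ s : ℤ, 0 < s → 0 < 1 - q ^ s := fun s hs =>
    sub_pos.mpr (zpow_lt_one₀ hq hq1 hs)
  set A := q ^ ((L : ℤ) + K - 2 * k - 1) * (1 - q ^ (k + 1)) * (1 - q ^ ((N : ℤ) - L - K + k + 1))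
    with hA
  set A' := q ^ ((L : ℤ) + K - 2 * (k + m) - 1) * (1 - q ^ (k + m + 1)) *
    (1 - q ^ ((N : ℤ) - L - K + (k + m) + 1)) with hA'
  set G := (1 - q ^ ((L : ℤ) - k)) * (1 - q ^ ((K : ℤ) - k))
  set G' := (1 - q ^ ((L : ℤ) - (k + m))) * (1 - q ^ ((K : ℤ) - (k + m)))
  have hA'pos : 0 < A' :=
    mul_pos (mul_pos (zpow_pos hq _) (pos _ (by omega))) (pos _ (by omega))
  have hAA' : A ≤ q ^ (2 * m) * A' := by
    have e : q ^ ((L : ℤ) + K - 2 * k - 1) =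
        q ^ (2 * m) * q ^ ((L : ℤ) + K - 2 * (k + m) - 1) := by
      rw [← zpow_natCast, ← zpow_add₀ hq.ne']
      congr 1; push_cast; ring
    rw [hA, hA', e, mul_assoc (q ^ (2 * m)), mul_assoc (q ^ (2 * m))]
    refine mul_le_mul_of_nonneg_left ?_ (pow_nonneg hq.le _)
    refine mul_le_mul ?_ (mono _ _ (by omega)) (pos _ (by omega)).le ?_
    · exact mul_le_mul_of_nonneg_left (mono _ _ (by omega)) (zpow_pos hq _).le
    · exact (mul_pos (zpow_pos hq _) (pos _ (by omega))).le
  have hGG' : G' ≤ G :=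
    mul_le_mul (mono _ _ (by omega)) (mono _ _ (by omega)) (pos _ (by omega)).le
      (pos _ (by omega)).le
  refine le_of_mul_le_mul_right ?_ hA'pos
  change heightProb N q L K (k + 1) * A = heightProb N q L K k * G at r1
  change heightProb N q L K (k + m + 1) * A' = heightProb N q L K (k + m) * G' at r2
  calc heightProb N q L K (k + m + 1) * heightProb N q L K k * A'
    _ = heightProb N q L K (k + m) * heightProb N q L K k * G' := by
        linear_combination heightProb N q L K k * r2
    _ ≤ heightProb N q L K (k + m) * heightProb N q L K k * G :=
        mul_le_mul_of_nonneg_left hGG' (mul_nonneg (nn _) (nn _))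
    _ = heightProb N q L K (k + m) * heightProb N q L K (k + 1) * A := by
        linear_combination -heightProb N q L K (k + m) * r1
    _ ≤ heightProb N q L K (k + m) * heightProb N q L K (k + 1) * (q ^ (2 * m) * A') :=
        mul_le_mul_of_nonneg_left hAA' (mul_nonneg (nn _) (nn _))
    _ = _ := by ring

theorem heightProb_succ_eq_exp_mul {N : ℕ} {q : ℝ} (hq : 0 < q) (hq1 : q < 1) {L K : ℕ} {k : ℤ}
    (h0 : 0 ≤ k) (h1 : (L : ℤ) + K - N ≤ k) (h2 : k < L) (h3 : k < K) :
    heightProb N q L K (k + 1) = Real.exp (-Real.log q * ((L : ℝ) + K - 2 * k - 1) +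
      logOneSubExp (-Real.log q * ((L : ℝ) - k)) + logOneSubExp (-Real.log q * ((K : ℝ) - k)) -
      logOneSubExp (-Real.log q * ((k : ℝ) + 1)) -
      logOneSubExp (-Real.log q * ((N : ℝ) - L - K + k + 1))) * heightProb N q L K k := by
  have key := prob_height_succ_mul hq h0 h1 h2 h3
  have hlam : 0 < -Real.log q := neg_pos.mpr (Real.log_neg hq hq1)
  have e : ∀ z : ℤ, 0 < z → 1 - q ^ z = Real.exp (logOneSubExp (-Real.log q * z)) := by
    intro z hz
    rw [zpow_eq_exp hq, exp_logOneSubExp (mul_pos hlam (by exact_mod_cast hz))]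
  rw [e _ (by omega), e _ (by omega), e _ (by omega), e _ (by omega), zpow_eq_exp hq] at key
  push_cast at key
  unfold heightProb
  rw [Real.exp_sub, Real.exp_sub, Real.exp_add, Real.exp_add]
  rw [Real.exp_neg] at key
  field_simp
  field_simp at key
  linear_combination key

/-- The limiting variance `1 / (β e ^ (2 d))` of the height, per unit of `N`. -/
noncomputable def varianceRate (β x y : ℝ) : ℝ := 1 / (β * Real.exp (2 * d β x y))

theorem varianceRate_pos {β : ℝ} (hβ : 0 < β) (x y : ℝ) : 0 < varianceRate β x y := by
  unfold varianceRate; positivity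

theorem sigma_eq_sqrt {β : ℝ} (hβ : 0 < β) (x y : ℝ) (N : ℕ) :
    σ N β x y = Real.sqrt (varianceRate β x y * N) := by
  unfold σ varianceRate
  have h1 : Real.exp (d β x y) = Real.sqrt (Real.exp (2 * d β x y)) := by
    rw [eq_comm, Real.sqrt_eq_iff_mul_self_eq (Real.exp_pos _).le (Real.exp_pos _).le,
      ← Real.exp_add]
    congr 1; ring
  rw [h1, ← Real.sqrt_mul hβ.le, ← Real.sqrt_div' _ (by positivity)]
  congr 1; ring

/-- Linearization of the log-odds at the limit shape. Positivity of the four exponents in the odds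
is also what places the heights in the support. -/
theorem exists_heightProb_succ_eq {β x y : ℝ} (hβ : 0 < β) (hx : x ∈ Set.Ioo (0 : ℝ) 1)
    (hy : y ∈ Set.Ioo (0 : ℝ) 1) :
    ∃ ε C : ℝ, 0 < ε ∧ 0 ≤ C ∧ ∀ᶠ N : ℕ in Filter.atTop, ∀ i : ℤ, |(i : ℝ)| ≤ ε * N →
      0 < heightProb N (1 - β / N) ⌊x * N⌋₊ ⌊y * N⌋₊ (⌊h β x y * N⌋ + i) ∧ ∃ ρ : ℝ,
        heightProb N (1 - β / N) ⌊x * N⌋₊ ⌊y * N⌋₊ (⌊h β x y * N⌋ + i + 1) =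
          Real.exp ρ * heightProb N (1 - β / N) ⌊x * N⌋₊ ⌊y * N⌋₊ (⌊h β x y * N⌋ + i) ∧
        |ρ + i / (varianceRate β x y * N)| ≤ C * (1 / N + (i : ℝ) ^ 2 / (N : ℝ) ^ 2) := by
  have t0 := h_pos hβ hx hy
  have t1 := h_lt_left hβ hx hy
  have t2 := h_lt_right hβ hx hy
  have t4 := one_sub_sub_add_h_pos hβ hx hy
  have hB : 0 ≤ 2 * β ^ 2 := by positivity
  have hbal := log_odds_h_eq_zero hβ hx hy
  have hslope := exp_two_mul_d_eq_sum hβ hx hy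
  have hx1 := hx.2
  have hy1 := hy.2
  have hx0 := hx.1
  have hy0 := hy.1
  set t := h β x y with ht
  obtain ⟨ε₁, C₁, n₁, hε₁, hC₁, H₁⟩ := exists_abs_logOneSubExp_mul_sub_le (w := x - t) (s := -1)
    hβ hB (by linarith) (by linarith) (by simp)
  obtain ⟨ε₂, C₂, n₂, hε₂, hC₂, H₂⟩ := exists_abs_logOneSubExp_mul_sub_le (w := y - t) (s := -1)
    hβ hB (by linarith) (by linarith) (by simp)
  obtain ⟨ε₃, C₃, n₃, hε₃, hC₃, H₃⟩ := exists_abs_logOneSubExp_mul_sub_le (w := t) (s := 1)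
    hβ hB (by linarith) (by linarith) (by simp)
  obtain ⟨ε₄, C₄, n₄, hε₄, hC₄, H₄⟩ := exists_abs_logOneSubExp_mul_sub_le (w := 1 - x - y + t)
    (s := 1) hβ hB (by linarith) (by linarith) (by simp)
  refine ⟨min 1 (min (min ε₁ ε₂) (min ε₃ ε₄)),
    8 * (2 * β ^ 2) + 3 * β + C₁ + C₂ + C₃ + C₄, by positivity, by positivity, ?_⟩
  filter_upwards [tendsto_natCast_atTop_atTop.eventually_ge_atTop n₁,
    tendsto_natCast_atTop_atTop.eventually_ge_atTop n₂,
    tendsto_natCast_atTop_atTop.eventually_ge_atTop n₃,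
    tendsto_natCast_atTop_atTop.eventually_ge_atTop n₄,
    tendsto_natCast_atTop_atTop.eventually_ge_atTop (1 : ℝ),
    tendsto_natCast_atTop_atTop.eventually_ge_atTop (2 * β)]
    with N hN₁ hN₂ hN₃ hN₄ hN hNβ i hi
  have hN0 : (0 : ℝ) < N := by linarith
  have hq : 0 < 1 - β / (N : ℝ) := by
    have : β / N ≤ 1 / 2 := by rw [div_le_iff₀ hN0]; linarith
    linarith
  have hq1 : 1 - β / (N : ℝ) < 1 := by
    have : 0 < β / N := by positivity
    linarith
  have hlam := abs_neg_log_one_sub_div_mul_sub_le hβ hNβ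
  have hlam0 : 0 < -Real.log (1 - β / (N : ℝ)) := neg_pos.mpr (Real.log_neg hq hq1)
  set q := 1 - β / (N : ℝ) with hqd
  set lam := -Real.log q with hlamd
  have hle : ∀ ε', min 1 (min (min ε₁ ε₂) (min ε₃ ε₄)) ≤ ε' → |(i : ℝ)| ≤ ε' * N :=
    fun ε' h => hi.trans (by gcongr)
  have hi0 : |(i : ℝ)| ≤ N := by
    have := hle 1 (min_le_left _ _)
    rwa [one_mul] at this
  have hmin := min_le_right 1 (min (min ε₁ ε₂) (min ε₃ ε₄))
  have hi1 := hle ε₁ (hmin.trans ((min_le_left _ _).trans (min_le_left _ _)))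
  have hi2 := hle ε₂ (hmin.trans ((min_le_left _ _).trans (min_le_right _ _)))
  have hi3 := hle ε₃ (hmin.trans ((min_le_right _ _).trans (min_le_left _ _)))
  have hi4 := hle ε₄ (hmin.trans ((min_le_right _ _).trans (min_le_right _ _)))
  set L := ⌊x * N⌋₊ with hLd
  set K := ⌊y * N⌋₊ with hKd
  have fL1 : (L : ℝ) ≤ x * N := Nat.floor_le (by positivity)
  have fL2 : x * N < L + 1 := Nat.lt_floor_add_one _
  have fK1 : (K : ℝ) ≤ y * N := Nat.floor_le (by positivity)
  have fK2 : y * N < K + 1 := Nat.lt_floor_add_one _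
  set k := ⌊t * N⌋ + i with hkd
  have hkr : (k : ℝ) = ⌊t * N⌋ + i := by rw [hkd]; push_cast; ring
  have fk1 : (⌊t * N⌋ : ℝ) ≤ t * N := Int.floor_le _
  have fk2 : t * N < ⌊t * N⌋ + 1 := Int.lt_floor_add_one _
  -- the four factors of the odds, at the limits `β (x - h)`, `β (y - h)`, `β h`, `β (1 - x - y + h)`
  obtain ⟨g1, b1⟩ := H₁ N lam ((L : ℝ) - k) i hN₁ hlam
    (by rw [abs_le]; constructor <;> linarith) hi1
  obtain ⟨g2, b2⟩ := H₂ N lam ((K : ℝ) - k) i hN₂ hlam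
    (by rw [abs_le]; constructor <;> linarith) hi2
  obtain ⟨g3, b3⟩ := H₃ N lam ((k : ℝ) + 1) i hN₃ hlam
    (by rw [abs_le]; constructor <;> linarith) hi3
  obtain ⟨g4, b4⟩ := H₄ N lam ((N : ℝ) - L - K + k + 1) i hN₄ hlam
    (by rw [abs_le]; constructor <;> linarith) hi4
  have b0 := abs_mul_sub_le (w := x + y - 2 * t) (s := -2) (z := (L : ℝ) + K - 2 * k - 1)
    (i := i) hβ hB (by rw [abs_le]; constructor <;> linarith) (by norm_num) hN hlam
    (by rw [abs_le]; constructor <;> linarith) hi0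
  have v1 : k < L := by
    have := pos_of_mul_pos_right g1 hlam0.le
    have : (k : ℝ) < L := by linarith
    exact_mod_cast this
  have v2 : k < K := by
    have := pos_of_mul_pos_right g2 hlam0.le
    have : (k : ℝ) < K := by linarith
    exact_mod_cast this
  have v3 : 0 ≤ k := by
    have := pos_of_mul_pos_right g3 hlam0.le
    have : 0 < k + 1 := by exact_mod_cast this
    omega
  have v4 : (L : ℤ) + K - N ≤ k := by
    have := pos_of_mul_pos_right g4 hlam0.le
    have : 0 < (N : ℤ) - L - K + k + 1 := by exact_mod_cast this
    omega
  refine ⟨prob_height_pos hq v3 v4 v1.le v2.le, _,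
    heightProb_succ_eq_exp_mul hq hq1 v3 v4 v1 v2, ?_⟩
  have hv : (i : ℝ) / (varianceRate β x y * N) = β * i / N * Real.exp (2 * d β x y) := by
    unfold varianceRate; field_simp
  rw [hv, hslope]
  set s := 1 / (N : ℝ) + (i : ℝ) ^ 2 / (N : ℝ) ^ 2 with hs
  have b0' : (8 * (2 * β ^ 2) + 3 * β) / (N : ℝ) ≤ (8 * (2 * β ^ 2) + 3 * β) * s := by
    rw [div_eq_mul_one_div, hs]
    gcongr
    have : 0 ≤ (i : ℝ) ^ 2 / (N : ℝ) ^ 2 := by positivity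
    linarith
  have b0'' := b0.trans b0'
  rw [abs_le] at b0'' b1 b2 b3 b4 ⊢
  have e : ∀ c : ℝ, c * (β * -1 * i / N) = -(c * (β * i / N)) := fun c => by ring
  have e' : ∀ c : ℝ, c * (β * 1 * i / N) = c * (β * i / N) := fun c => by ring
  have e'' : β * -2 * i / N = -(2 * (β * i / N)) := by ring
  rw [e] at b1 b2
  rw [e'] at b3 b4
  rw [e''] at b0''
  rw [show β * i / (N : ℝ) * (2 + (Real.exp (β * (x - t)) - 1)⁻¹ + (Real.exp (β * (y - t)) - 1)⁻¹ +
    (Real.exp (β * t) - 1)⁻¹ + (Real.exp (β * (1 - x - y + t)) - 1)⁻¹) =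
    2 * (β * i / N) + (Real.exp (β * (x - t)) - 1)⁻¹ * (β * i / N) +
    (Real.exp (β * (y - t)) - 1)⁻¹ * (β * i / N) +
    (Real.exp (β * t) - 1)⁻¹ * (β * i / N) +
    (Real.exp (β * (1 - x - y + t)) - 1)⁻¹ * (β * i / N) by ring]
  rw [show (8 * (2 * β ^ 2) + 3 * β + C₁ + C₂ + C₃ + C₄) * s = (8 * (2 * β ^ 2) + 3 * β) * s +
    C₁ * s + C₂ * s + C₃ * s + C₄ * s by ring]
  constructor <;> linarith [b0''.1, b0''.2, b1.1, b1.2, b2.1, b2.2, b3.1, b3.2, b4.1, b4.2]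

/-! ### The local limit theorem -/

/-- The law of the height, recentred at the integer part of `h N`, satisfies the hypotheses of
`exists_eq_exp_of_increments` and of `exists_abs_inv_sub_sqrt_le`. -/
theorem exists_heightProb_increments {β x y : ℝ} (hβ : 0 < β) (hx : x ∈ Set.Ioo (0 : ℝ) 1)
    (hy : y ∈ Set.Ioo (0 : ℝ) 1) :
    ∃ ε C : ℝ, 0 < ε ∧ 0 ≤ C ∧ ∀ᶠ N : ℕ in Filter.atTop, ∀ p : ℤ → ℝ,
      (∀ j, p j = heightProb N (1 - β / N) ⌊x * N⌋₊ ⌊y * N⌋₊ (⌊h β x y * N⌋ + j)) →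
      0 < p 0 ∧
      (∀ s : ℤ, s = 1 ∨ s = -1 → ∀ j : ℕ, (j : ℝ) + 1 ≤ ε * N →
        ∃ ρ : ℝ, p (s * (j + 1 : ℕ)) = Real.exp ρ * p (s * j) ∧
        |ρ + j / (varianceRate β x y * N)| ≤ C * (1 / N + (j : ℝ) ^ 2 / (N : ℝ) ^ 2)) ∧
      (∀ s : ℤ, s = 1 ∨ s = -1 → ∀ j : ℕ,
        p (s * (j + 1 : ℕ)) ≤ Real.exp (C / N - 2 * β * j / N) * p (s * j)) := by
  obtain ⟨ε, C, hε, hC, H⟩ := exists_heightProb_succ_eq hβ hx hy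
  have hv := varianceRate_pos hβ x y
  set v := varianceRate β x y
  refine ⟨ε, 3 * C + 1 / v, hε, by positivity, ?_⟩
  filter_upwards [H, tendsto_natCast_atTop_atTop.eventually_ge_atTop (1 : ℝ),
    tendsto_natCast_atTop_atTop.eventually_ge_atTop (1 / ε),
    tendsto_natCast_atTop_atTop.eventually_ge_atTop (2 * β)] with N hN hN1 hNε hNβ p hp
  have hN0 : (0 : ℝ) < N := by linarith
  have hεN : 1 ≤ ε * N := by rwa [div_le_iff₀' hε] at hNε
  have hβN : β / (N : ℝ) ≤ 1 / 2 := by rw [div_le_iff₀ hN0]; linarith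
  have hβN0 : 0 < β / (N : ℝ) := by positivity
  have step : ∀ i : ℤ, |(i : ℝ)| ≤ ε * N → 0 < p i ∧ ∃ ρ : ℝ, p (i + 1) = Real.exp ρ * p i ∧
      |ρ + i / (v * N)| ≤ C * (1 / N + (i : ℝ) ^ 2 / (N : ℝ) ^ 2) := by
    intro i hi
    obtain ⟨h1, ρ, h2, h3⟩ := hN i hi
    rw [hp, hp, ← add_assoc]
    exact ⟨h1, ρ, h2, h3⟩
  have nn : ∀ j, 0 ≤ p j := fun j => by
    rw [hp]; exact heightProb_nonneg N (by linarith) _ _ _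
  have conc : ∀ (i : ℤ) (m : ℕ), p (i + m + 1) * p i ≤
      Real.exp (-2 * β * m / N) * (p (i + m) * p (i + 1)) := by
    intro i m
    have h1 := heightProb_mul_le (q := 1 - β / N) (N := N) (L := ⌊x * N⌋₊) (K := ⌊y * N⌋₊)
      (by linarith) (by linarith)
      (Nat.floor_le_of_le (by nlinarith [hx.2])) (Nat.floor_le_of_le (by nlinarith [hy.2]))
      (⌊h β x y * N⌋ + i) m
    simp only [add_assoc] at h1
    rw [← hp, ← hp, ← hp, ← hp, ← add_assoc] at h1
    refine h1.trans (mul_le_mul_of_nonneg_right ?_ (mul_nonneg (nn _) (nn _)))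
    have h2 : 1 - β / (N : ℝ) ≤ Real.exp (-(β / N)) := Real.one_sub_le_exp_neg _
    calc _ ≤ Real.exp (-(β / N)) ^ (2 * m) := pow_le_pow_left₀ (by linarith) h2 _
      _ = _ := by rw [← Real.exp_nat_mul]; congr 1; push_cast; ring
  have hinv : 1 / (N : ℝ) ^ 2 ≤ 1 / N := by
    apply one_div_le_one_div_of_le hN0; nlinarith
  obtain ⟨hp0, ρ₀, hρ₀, hρ₀'⟩ := step 0 (by simp; positivity)
  obtain ⟨hp1, ρ₁, hρ₁, hρ₁'⟩ := step (-1) (by simpa using hεN)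
  refine ⟨hp0, ?_, ?_⟩
  · rintro s (rfl | rfl) j hj
    · obtain ⟨-, ρ, h1, h2⟩ := step j (by rw [Int.cast_natCast, Nat.abs_cast]; linarith)
      refine ⟨ρ, by push_cast; simpa using h1, ?_⟩
      rw [Int.cast_natCast] at h2
      refine h2.trans (mul_le_mul_of_nonneg_right ?_ (by positivity))
      have : 0 ≤ 1 / v := by positivity
      linarith
    · obtain ⟨-, ρ, h1, h2⟩ := step (-(j + 1 : ℕ)) (by
        rw [Int.cast_neg, abs_neg, Int.cast_natCast, Nat.abs_cast]; push_cast; exact hj)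
      refine ⟨-ρ, ?_, ?_⟩
      · have e : -((j + 1 : ℕ) : ℤ) + 1 = -1 * j := by push_cast; ring
        rw [e] at h1
        rw [h1, ← mul_assoc, ← Real.exp_add, neg_add_cancel, Real.exp_zero, one_mul, neg_one_mul]
      · push_cast at h2
        have e : -ρ + j / (v * N) = -(ρ + (-1 + -(j : ℝ)) / (v * N)) + -(1 / v * (1 / N)) := by
          field_simp; ring
        have h2' : |ρ + (-1 + -(j : ℝ)) / (v * N)| ≤
            C * (1 / N + (-1 + -(j : ℝ)) ^ 2 / (N : ℝ) ^ 2) := by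
          convert h2 using 4 <;> ring
        rw [e]
        refine (abs_add_le _ _).trans ?_
        rw [abs_neg, abs_neg, abs_of_pos (show 0 < 1 / v * (1 / (N : ℝ)) by positivity)]
        have h3 : (-1 + -(j : ℝ)) ^ 2 / (N : ℝ) ^ 2 ≤ 2 * (1 / N) + 2 * (j ^ 2 / (N : ℝ) ^ 2) := by
          have : (-1 + -(j : ℝ)) ^ 2 / (N : ℝ) ^ 2 ≤ (2 + 2 * j ^ 2) / (N : ℝ) ^ 2 := by
            gcongr; nlinarith [sq_nonneg ((j : ℝ) - 1)]
          have e2 : (2 + 2 * (j : ℝ) ^ 2) / (N : ℝ) ^ 2 =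
            2 * (1 / (N : ℝ) ^ 2) + 2 * (j ^ 2 / (N : ℝ) ^ 2) := by ring
          linarith
        have h4 : C * (1 / N + (-1 + -(j : ℝ)) ^ 2 / (N : ℝ) ^ 2) ≤
            C * (3 * (1 / N) + 3 * (j ^ 2 / (N : ℝ) ^ 2)) := by
          refine mul_le_mul_of_nonneg_left ?_ hC
          have : 0 ≤ (j : ℝ) ^ 2 / (N : ℝ) ^ 2 := by positivity
          linarith
        have h5 : 0 ≤ 1 / v * ((j : ℝ) ^ 2 / (N : ℝ) ^ 2) := by positivity
        linarith
  · have hvC : 0 ≤ 1 / v := by positivity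
    rintro s (rfl | rfl) j
    · have h1 := conc 0 j
      rw [hρ₀] at h1
      have h2 : ρ₀ ≤ (3 * C + 1 / v) / N := by
        have h3 := (le_abs_self _).trans hρ₀'
        simp only [Int.cast_zero, zero_div, add_zero, ne_eq, OfNat.ofNat_ne_zero,
          not_false_eq_true, zero_pow] at h3
        refine h3.trans ?_
        rw [mul_one_div]
        gcongr
        linarith
      refine le_of_mul_le_mul_right ?_ hp0
      have e : (1 : ℤ) * (j + 1 : ℕ) = 0 + j + 1 := by push_cast; ring
      have e' : (1 : ℤ) * j = 0 + j := by ring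
      rw [e, e']
      refine h1.trans ?_
      calc _ = Real.exp (ρ₀ + -2 * β * j / N) * p (0 + j) * p 0 := by rw [Real.exp_add]; ring
        _ ≤ _ := by
          refine mul_le_mul_of_nonneg_right (mul_le_mul_of_nonneg_right
            (Real.exp_le_exp.mpr ?_) (nn _)) hp0.le
          have : -2 * β * j / (N : ℝ) = -(2 * β * j / N) := by ring
          linarith
    · have h1 := conc (-1 - j) j
      rw [show (-1 : ℤ) - j + j = -1 by ring, show (-1 : ℤ) + 1 = 0 by ring] at h1
      rw [show (-1 : ℤ) + 1 = 0 by ring] at hρ₁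
      have h2 : -ρ₁ ≤ (3 * C + 1 / v) / N := by
        have h3 := (neg_le_abs _).trans hρ₁'
        push_cast at h3
        have e1 : -1 / (v * N) = -(1 / v / N) := by field_simp
        have e2 : (-1 : ℝ) ^ 2 = 1 := by norm_num
        have h4 : C * (1 / N + (-1) ^ 2 / (N : ℝ) ^ 2) ≤ C * (3 * (1 / N)) := by
          gcongr
          rw [e2]
          have : 0 < 1 / (N : ℝ) := by positivity
          linarith
        have e3 : (3 * C + 1 / v) / N = C * (3 * (1 / N)) + 1 / v / N := by ring
        have h5 : 0 ≤ 1 / v / N := by positivity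
        rw [e1] at h3
        rw [e3]
        have h6 : -ρ₁ + 1 / v / N ≤ C * (3 * (1 / N)) := by linarith
        linarith
      refine le_of_mul_le_mul_right ?_ hp0
      have e : (-1 : ℤ) * (j + 1 : ℕ) = -1 - j := by push_cast; ring
      have e' : (-1 : ℤ) * j = -1 - j + 1 := by ring
      rw [e, e']
      have hm : p (-1) = Real.exp (-ρ₁) * p 0 := by
        rw [hρ₁, ← mul_assoc, ← Real.exp_add, neg_add_cancel, Real.exp_zero, one_mul]
      rw [hm] at h1
      rw [mul_comm]
      refine h1.trans ?_
      calc _ = Real.exp (-ρ₁ + -2 * β * j / N) * p (-1 - j + 1) * p 0 := by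
            rw [Real.exp_add]; ring
        _ ≤ _ := by
          refine mul_le_mul_of_nonneg_right (mul_le_mul_of_nonneg_right
            (Real.exp_le_exp.mpr ?_) (nn _)) hp0.le
          have : -2 * β * j / (N : ℝ) = -(2 * β * j / N) := by ring
          linarith

theorem tendsto_pow_three_div_sqrt {A : ℕ → ℝ}
    (hA : Filter.Tendsto (fun N : ℕ => A N / (N : ℝ) ^ (1 / 6 : ℝ)) Filter.atTop (nhds 0)) :
    Filter.Tendsto (fun N : ℕ => A N ^ 3 / Real.sqrt N) Filter.atTop (nhds 0) := by
  have h1 := hA.pow 3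
  rw [zero_pow (by norm_num)] at h1
  refine h1.congr fun N => ?_
  rw [div_pow]
  congr 1
  rw [← Real.rpow_natCast, ← Real.rpow_mul (Nat.cast_nonneg N), Real.sqrt_eq_rpow]
  norm_num

theorem abs_mul_sqrt_sub_one_le {p S M : ℝ} (hp : 0 < p) (hS : 0 < S) (hM : |1 / p - S| ≤ M)
    (hMS : 2 * M ≤ S) : |S * p - 1| ≤ 2 * M / S := by
  have h1 : S / 2 ≤ 1 / p := by linarith [(abs_le.mp hM).1]
  have h2 : p ≤ 2 / S := by
    rw [le_div_iff₀ hp] at h1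
    rw [le_div_iff₀ hS]
    linarith
  have h3 : S * p - 1 = -(p * (1 / p - S)) := by field_simp; ring
  rw [h3, abs_neg, abs_mul, abs_of_pos hp]
  calc p * |1 / p - S| ≤ 2 / S * M := by gcongr
    _ = _ := by ring

/-- The quotient of a probability by the Gaussian density, in logarithmic form. -/
theorem div_gaussianPDFReal_eq {v n : ℝ} (hv : 0 < v) (hn : 0 < n) (P t : ℝ) :
    Real.sqrt (v * n) * P / ProbabilityTheory.gaussianPDFReal 0 1 (t / Real.sqrt (v * n)) =
      Real.sqrt (2 * Real.pi * v * n) * P * Real.exp (t ^ 2 / (2 * v * n)) := by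
  unfold ProbabilityTheory.gaussianPDFReal
  have hpi := Real.pi_pos
  have e1 : Real.sqrt (2 * Real.pi * v * n) = Real.sqrt (2 * Real.pi) * Real.sqrt (v * n) := by
    rw [← Real.sqrt_mul (by positivity)]; congr 1; ring
  have e2 : -(t / Real.sqrt (v * n) - 0) ^ 2 / (2 * ((1 : NNReal) : ℝ)) =
      -(t ^ 2 / (2 * v * n)) := by
    rw [sub_zero, div_pow, Real.sq_sqrt (by positivity)]
    push_cast
    field_simp
  rw [e1, e2, Real.exp_neg]
  have h1 : 0 < Real.sqrt (2 * Real.pi) := Real.sqrt_pos.mpr (by positivity)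
  push_cast
  rw [mul_one]
  field_simp

/-- The local estimate with explicit errors: the quotient of the probability by the density is a
normalising factor `G` times the exponential of the error `F` of the quadratic expansion. -/
theorem exists_quotient_eq {β x y : ℝ} (hβ : 0 < β) (hx : x ∈ Set.Ioo (0 : ℝ) 1)
    (hy : y ∈ Set.Ioo (0 : ℝ) 1) :
    ∃ ε C : ℝ, 0 < ε ∧ 0 ≤ C ∧ ∀ᶠ N : ℕ in Filter.atTop, ∀ (k : ℤ) (t : ℝ),
      |(k : ℝ) - h β x y * N| + 1 ≤ t → t ≤ ε * N →
      ∃ G F : ℝ, σ N β x y * prob N (1 - β / N) {w | (height ⌊x * N⌋₊ ⌊y * N⌋₊ w : ℤ) = k} /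
          ProbabilityTheory.gaussianPDFReal 0 1 (((k : ℝ) - h β x y * N) / σ N β x y) =
            G * Real.exp F ∧
        |G - 1| ≤ C / Real.sqrt N ∧ |F| ≤ C * (t / N + t ^ 3 / (N : ℝ) ^ 2) := by
  obtain ⟨ε, C, hε, hC, H⟩ := exists_heightProb_increments hβ hx hy
  have hv := varianceRate_pos hβ x y
  simp only [sigma_eq_sqrt hβ]
  set v := varianceRate β x y
  obtain ⟨M, n₀, hM, hnorm⟩ := exists_abs_inv_sub_sqrt_le hv hC hε hβ
  have hpi := Real.pi_pos
  set M' := 2 * M / Real.sqrt (2 * Real.pi * v) with hM'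
  have hM'0 : 0 ≤ M' := by positivity
  have hsqrt : Filter.Tendsto (fun N : ℕ => Real.sqrt (2 * Real.pi * v * N)) Filter.atTop
      Filter.atTop :=
    Real.tendsto_sqrt_atTop.comp
      (tendsto_natCast_atTop_atTop.const_mul_atTop (by positivity))
  refine ⟨ε, M' + (C + 1 / (2 * v)) + 3 / (2 * v), hε, by positivity, ?_⟩
  filter_upwards [H, tendsto_natCast_atTop_atTop.eventually_ge_atTop n₀,
    tendsto_natCast_atTop_atTop.eventually_ge_atTop (1 : ℝ),
    tendsto_natCast_atTop_atTop.eventually_ge_atTop (2 * β),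
    hsqrt.eventually_ge_atTop (2 * M)] with N hN hNn hN1 hNβ hNM k t hkt htε
  have hN0 : (0 : ℝ) < N := by linarith
  have hr0 : 0 < Real.sqrt N := Real.sqrt_pos.mpr hN0
  set p : ℤ → ℝ := fun j =>
    heightProb N (1 - β / N) ⌊x * N⌋₊ ⌊y * N⌋₊ (⌊h β x y * N⌋ + j) with hp
  obtain ⟨hp0, hinc, hle⟩ := hN p fun _ => rfl
  have hq : 0 ≤ 1 - β / (N : ℝ) := by
    have : β / (N : ℝ) ≤ 1 / 2 := by rw [div_le_iff₀ hN0]; linarith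
    linarith
  have hsum : HasSum p 1 := hasSum_heightProb_add N hq _ _ _
  have hnn : ∀ j, 0 ≤ p j := fun j => heightProb_nonneg N hq _ _ _
  have hcentre := abs_mul_sqrt_sub_one_le hp0 (by positivity)
    (hnorm N p hNn hp0 hnn hsum hinc hle) hNM
  -- the distance `m` from `k` to the centre, and the error `f` of rounding `h N`
  obtain ⟨s, m, hs, hj⟩ : ∃ (s : ℤ) (m : ℕ), (s = 1 ∨ s = -1) ∧ k - ⌊h β x y * N⌋ = s * m := by
    obtain ⟨m, hm | hm⟩ := Int.eq_nat_or_neg (k - ⌊h β x y * N⌋)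
    · exact ⟨1, m, Or.inl rfl, by rw [hm]; simp⟩
    · exact ⟨-1, m, Or.inr rfl, by rw [hm]; simp⟩
  set f := h β x y * N - ⌊h β x y * N⌋ with hf
  have hf0 : 0 ≤ f := sub_nonneg.mpr (Int.floor_le _)
  have hf1 : f ≤ 1 := by
    have := Int.lt_floor_add_one (h β x y * N)
    linarith
  have hkf : (k : ℝ) - h β x y * N = s * m - f := by
    have : (k : ℝ) - ⌊h β x y * N⌋ = s * m := by exact_mod_cast hj
    rw [hf]; linarith
  have hsr : (s : ℝ) = 1 ∨ (s : ℝ) = -1 := by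
    rcases hs with rfl | rfl <;> simp
  have hm0 : (0 : ℝ) ≤ m := Nat.cast_nonneg m
  have hmt : (m : ℝ) ≤ t := by
    refine le_trans ?_ hkt
    rw [hkf]
    rcases hsr with h | h <;> rw [h]
    · linarith [le_abs_self (1 * (m : ℝ) - f)]
    · linarith [neg_le_abs (-1 * (m : ℝ) - f)]
  have ht1 : 1 ≤ t := by linarith [abs_nonneg ((k : ℝ) - h β x y * N)]
  obtain ⟨E, hE, hE'⟩ := exists_eq_exp_of_increments hv hC hN0
    (u := fun m : ℕ => p (s * m)) (hinc s hs) m (hmt.trans htε)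
  have hprob : prob N (1 - β / N) {w | (height ⌊x * N⌋₊ ⌊y * N⌋₊ w : ℤ) = k} =
      p 0 * Real.exp (-(m : ℝ) ^ 2 / (2 * v * N) + E) := by
    simp only [Nat.cast_zero, mul_zero] at hE
    rw [← hE, hp]
    simp only [heightProb]
    rw [← hj, add_sub_cancel]
  rw [div_gaussianPDFReal_eq hv hN0, hprob]
  set S := Real.sqrt (2 * Real.pi * v * N)
  refine ⟨S * p 0, E + ((s * m - f) ^ 2 - (m : ℝ) ^ 2) / (2 * v * N), ?_, ?_, ?_⟩
  · rw [← mul_assoc, mul_assoc (S * p 0), ← Real.exp_add, hkf]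
    congr 2
    ring
  · have h1 : S = Real.sqrt (2 * Real.pi * v) * Real.sqrt N := Real.sqrt_mul (by positivity) _
    calc _ ≤ 2 * M / S := hcentre
      _ = M' / Real.sqrt N := by rw [h1, hM']; field_simp
      _ ≤ _ := by
        apply div_le_div_of_nonneg_right _ hr0.le
        have : 0 ≤ C + 1 / (2 * v) + 3 / (2 * v) := by positivity
        linarith
  · have h2 : |(s * m - f) ^ 2 - (m : ℝ) ^ 2| ≤ 3 * t := by
      have h3 : (m : ℝ) * f ≤ m := mul_le_of_le_one_right hm0 hf1
      have h4 : 0 ≤ (m : ℝ) * f := mul_nonneg hm0 hf0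
      have h5 : f ^ 2 ≤ 1 := pow_le_one₀ hf0 hf1
      have h6 : (s : ℝ) ^ 2 = 1 := by rcases hsr with h | h <;> rw [h] <;> norm_num
      have h7 : (s * m - f) ^ 2 - (m : ℝ) ^ 2 = -(2 * s * (m * f)) + f ^ 2 := by
        linear_combination (m : ℝ) ^ 2 * h6
      rw [h7, abs_le]
      rcases hsr with h | h <;> rw [h] <;> constructor <;> linarith [sq_nonneg f]
    have h1 : |((s * m - f) ^ 2 - (m : ℝ) ^ 2) / (2 * v * N)| ≤ 3 / (2 * v) * (t / N) := by
      rw [abs_div, abs_of_pos (show 0 < 2 * v * (N : ℝ) by positivity)]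
      calc _ ≤ 3 * t / (2 * v * (N : ℝ)) := by gcongr
        _ = _ := by field_simp
    have h3 : |E| ≤ (C + 1 / (2 * v)) * (t / N + t ^ 3 / (N : ℝ) ^ 2) :=
      hE'.trans (by gcongr)
    refine (abs_add_le _ _).trans ((add_le_add h3 h1).trans ?_)
    have h4 : 0 ≤ M' * (t / N + t ^ 3 / (N : ℝ) ^ 2) := by positivity
    have h5 : 0 ≤ 3 / (2 * v) * (t ^ 3 / (N : ℝ) ^ 2) := by positivity
    linarith

end Mallows

theorem theorem4p6 (β : ℝ) (hβ : 0 < β)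
    (A : ℕ → ℝ) (hA_mono : Monotone A)
    (hA : Filter.Tendsto (fun N : ℕ => A N / (N : ℝ) ^ (1 / 6 : ℝ)) Filter.atTop (nhds 0))
    (x y : ℝ) (hx : x ∈ Set.Ioo (0 : ℝ) 1) (hy : y ∈ Set.Ioo (0 : ℝ) 1) :
    ∃ C : ℝ, ∀ᶠ N : ℕ in Filter.atTop, ∀ k : ℤ,
      |(k : ℝ) - Mallows.h β x y * N| < Real.sqrt N * A N →
        |Mallows.σ N β x y *
              Mallows.prob N (1 - β / N)
                {w | (Mallows.height ⌊x * N⌋₊ ⌊y * N⌋₊ w : ℤ) = k} /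
            ProbabilityTheory.gaussianPDFReal 0 1
              (((k : ℝ) - Mallows.h β x y * N) / Mallows.σ N β x y) - 1|
          ≤ C * (A N ^ 3 / Real.sqrt N) := by
  by_cases hpos : ∃ N₀, 0 < A N₀
  swap
  · -- no `k` satisfies the strict inequality
    push Not at hpos
    refine ⟨0, Filter.Eventually.of_forall fun N k hk => absurd hk (not_lt.mpr ?_)⟩
    exact (mul_nonpos_of_nonneg_of_nonpos (Real.sqrt_nonneg _) (hpos N)).trans (abs_nonneg _)
  obtain ⟨N₀, ha⟩ := hpos
  set a := A N₀
  obtain ⟨ε, C, hε, hC, H⟩ := Mallows.exists_quotient_eq hβ hx hy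
  -- since `A N ≥ a` eventually, lower powers of `A N` are bounded by `A N ^ 3`
  set b := 1 + 1 / a with hb
  have hb0 : 0 < b := by positivity
  set C₂ := C * (b / a ^ 2 + b ^ 3) with hC₂
  have hC₂0 : 0 ≤ C₂ := by positivity
  have hR := Mallows.tendsto_pow_three_div_sqrt hA
  refine ⟨3 * (C * (1 / a ^ 3)) + 2 * C₂, ?_⟩
  filter_upwards [H, tendsto_natCast_atTop_atTop.eventually_ge_atTop (1 : ℝ),
    hR.eventually (gt_mem_nhds (show 0 < 1 / (C₂ + 1) by positivity)),
    hR.eventually (gt_mem_nhds (show 0 < a ^ 2 * ε / b by positivity)),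
    Filter.eventually_ge_atTop N₀] with N hN hN1 hRN hRε hNN k hk
  have hN0 : (0 : ℝ) < N := by linarith
  have haN : a ≤ A N := hA_mono hNN
  have hA0 : 0 < A N := ha.trans_le haN
  set r := Real.sqrt N with hr
  have hr0 : 0 < r := Real.sqrt_pos.mpr hN0
  have hr1 : 1 ≤ r := Real.one_le_sqrt.mpr hN1
  have hrN : r ^ 2 = N := Real.sq_sqrt hN0.le
  set R := A N ^ 3 / r with hRd
  have hR0 : 0 < R := by positivity
  have hkb : |(k : ℝ) - Mallows.h β x y * N| + 1 ≤ b * (r * A N) := by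
    have h1 : 1 ≤ 1 / a * (r * A N) := by
      rw [one_div, inv_mul_eq_div, one_le_div ha]
      nlinarith
    rw [hb, add_mul, one_mul]
    linarith
  have hbN : b * (r * A N) / N ≤ b / a ^ 2 * R := by
    have hAR : A N / r ≤ R / a ^ 2 := by
      rw [hRd, div_div, div_le_div_iff₀ hr0 (by positivity)]
      have : A N * a ^ 2 ≤ A N * A N ^ 2 := by gcongr
      nlinarith
    calc _ = b * (A N / r) := by rw [← hrN]; field_simp
      _ ≤ b * (R / a ^ 2) := by gcongr
      _ = _ := by ring
  have hbN3 : (b * (r * A N)) ^ 3 / (N : ℝ) ^ 2 = b ^ 3 * R := by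
    rw [← hrN, hRd]; field_simp
  have hbε : b * (r * A N) ≤ ε * N := by
    rw [← div_le_iff₀ hN0]
    refine hbN.trans ?_
    calc b / a ^ 2 * R ≤ b / a ^ 2 * (a ^ 2 * ε / b) := by gcongr
      _ = ε := by field_simp
  obtain ⟨G, F, hGF, hG, hF⟩ := hN k _ hkb hbε
  rw [hGF]
  have hF' : |F| ≤ C₂ * R := by
    refine hF.trans ?_
    rw [hbN3, hC₂, mul_assoc]
    exact mul_le_mul_of_nonneg_left (by linarith) hC
  have hF1 : |F| ≤ 1 := by
    refine hF'.trans ?_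
    have h1 : C₂ * R ≤ C₂ * (1 / (C₂ + 1)) := by gcongr
    refine h1.trans ?_
    rw [mul_one_div, div_le_one (by positivity)]
    linarith
  have hexp : Real.exp F ≤ 3 := by
    have := Real.exp_le_exp.mpr ((le_abs_self F).trans hF1)
    linarith [Real.exp_one_lt_d9]
  have hexp1 := Real.abs_exp_sub_one_le hF1
  have hG' : |G - 1| ≤ C * (1 / a ^ 3) * R := by
    have h2 : 1 ≤ 1 / a ^ 3 * A N ^ 3 := by
      rw [one_div, inv_mul_eq_div, one_le_div (by positivity)]
      gcongr
    calc _ ≤ C / r := hG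
      _ = C * 1 / r := by rw [mul_one]
      _ ≤ C * (1 / a ^ 3 * A N ^ 3) / r := by gcongr
      _ = _ := by rw [hRd]; ring
  have e2 : G * Real.exp F - 1 = (G - 1) * Real.exp F + (Real.exp F - 1) := by ring
  rw [e2]
  refine (abs_add_le _ _).trans ?_
  rw [abs_mul, abs_of_pos (Real.exp_pos F)]
  calc _ ≤ C * (1 / a ^ 3) * R * 3 + 2 * (C₂ * R) := by
        refine add_le_add ?_ (hexp1.trans (by gcongr))
        exact mul_le_mul hG' hexp (Real.exp_pos F).le (by positivity)
    _ = _ := by ring
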